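/- All graphs are finite and simple. In a drawing of a graph in the plane, vertices are distinct points and every edge is a simple arc joining its endvertices and containing no other vertex; adjacent edges meet only in their common endvertex, and two edges meeting in a point that is not a vertex cross properly there. A drawing is 1-planar if every edge is crossed at most once. For a 1-planar drawing $D$, the associated plane graph $D^\times$ is obtained by turning each crossing into a new vertex of degree four (a false vertex). A graph is of class $\mathcal C_0$ if it has a 1-planar drawing $D$ such that $|N_{D^\times}(c_1)\cap N_{D^\times}(c_2)|=0$ for any two distinct false vertices $c_1,c_2$ of $D^\times$. Let $P_1$ be the one-vertex graph, and let $G+P_1$ be the join, i.e. $G$ together with a new vertex adjacent to all vertices of $G$. (i) If $|V(G)|\ge 2$ and $G+P_1$ is of class $\mathcal C_0$, then $|E(G)|\le 2.25\,|V(G)|-2.75$. (ii) The bound is tight: for every even $k\ge 4$, with $n=2k$, let $G_{n-1}$ be the graph with the $n-1$ vertices $a_1,\dots,a_k,b_1,\dots,b_{k-1}$ consisting of the two paths $a_1a_2\dots a_k$ and $b_1b_2\dots b_{k-1}$, the edges $a_ib_i$ and $a_{i+1}b_i$ for $i\in\{1,\dots,k-1\}$, the edge $a_{k-2}a_k$,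 and the edges $a_{j-1}b_j$ for every even $j\in\{2,\dots,k-2\}$. Then $G_{n-1}+P_1$ is of class $\mathcal C_0$ and $|E(G_{n-1})|=2.25(n-1)-2.75$. -/

import Mathlib

/-- `A` is a simple arc in the plane with end points `p` and `q`: the image of an injective
continuous path from `p` to `q`. -/
def IsSimpleArc (A : Set (ℝ × ℝ)) (p q : ℝ × ℝ) : Prop :=
  ∃ γ : Path p q, Function.Injective γ ∧ Set.range γ = A

/-- The sets `A` and `B` cross properly at `c`: in a suitable local chart of the plane around
`c` they become the two coordinate axes through the origin (so they do not merely touch). -/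
def CrossProperlyAt (A B : Set (ℝ × ℝ)) (c : ℝ × ℝ) : Prop :=
  ∃ φ : OpenPartialHomeomorph (ℝ × ℝ) (ℝ × ℝ), c ∈ φ.source ∧ φ c = (0, 0) ∧
    ∀ x ∈ φ.source, (x ∈ A ↔ (φ x).1 = 0) ∧ (x ∈ B ↔ (φ x).2 = 0)

/-- A drawing of a graph in the plane, with the usual conventions: vertices are distinct points,
every edge is a simple arc that joins its end vertices and contains no other vertex, two
adjacent edges meet only in their common end vertex, and two edges that meet in a point
which is not a vertex cross properly there.

The values of `arc` outside the edge set of `G` are irrelevant. -/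
structure PlaneDrawing {V : Type*} (G : SimpleGraph V) where
  pos : V → ℝ × ℝ
  arc : Sym2 V → Set (ℝ × ℝ)
  pos_injective : Function.Injective pos
  isSimpleArc : ∀ u v, G.Adj u v → IsSimpleArc (arc s(u, v)) (pos u) (pos v)
  mem_of_pos_mem : ∀ e ∈ G.edgeSet, ∀ w, pos w ∈ arc e → w ∈ e
  adjacent_meet : ∀ u v w, G.Adj u v → G.Adj u w → v ≠ w →
    arc s(u, v) ∩ arc s(u, w) = {pos u}
  proper : ∀ e ∈ G.edgeSet, ∀ f ∈ G.edgeSet, e ≠ f → ∀ c ∈ arc e ∩ arc f,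
    c ∉ Set.range pos → CrossProperlyAt (arc e) (arc f) c

namespace PlaneDrawing

/-- The edges `e` and `f` of `G` cross at the point `c` in the drawing `D`. -/
def Crosses {V : Type*} {G : SimpleGraph V} (D : PlaneDrawing G)
    (e f : Sym2 V) (c : ℝ × ℝ) : Prop :=
  e ∈ G.edgeSet ∧ f ∈ G.edgeSet ∧ e ≠ f ∧ c ∈ D.arc e ∧ c ∈ D.arc f ∧ c ∉ Set.range D.pos

/-- A drawing is 1-planar if every edge is crossed at most once: it is crossed by at most one
other edge, and in at most one point. -/
def IsOnePlanar {V : Type*} {G : SimpleGraph V} (D : PlaneDrawing G) : Prop :=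
  ∀ e f f' c c', D.Crosses e f c → D.Crosses e f' c' → f = f' ∧ c = c'

/-- The crossings of a drawing, that is, the false vertices of the associated plane graph. -/
def FalseVertex {V : Type*} {G : SimpleGraph V} (D : PlaneDrawing G) : Type :=
  {c : ℝ × ℝ // ∃ e f, D.Crosses e f c}

/-- The adjacency of the associated plane graph of a 1-planar drawing. Two true vertices are
adjacent if they are joined by an uncrossed edge. A crossed edge `uv` is split by its crossing
`c` into the two edges `uc` and `cv`; so a true vertex and a false vertex are adjacent if an edge
at the true vertex passes through the false vertex. Two false vertices are never adjacent,
because no edge is crossed twice. -/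
def AssociatedAdj {V : Type*} {G : SimpleGraph V} (D : PlaneDrawing G) :
    V ⊕ D.FalseVertex → V ⊕ D.FalseVertex → Prop
  | .inl u, .inl v => G.Adj u v ∧ ∀ f c, ¬ D.Crosses s(u, v) f c
  | .inl u, .inr c => ∃ e ∈ G.edgeSet, u ∈ e ∧ c.1 ∈ D.arc e
  | .inr c, .inl u => ∃ e ∈ G.edgeSet, u ∈ e ∧ c.1 ∈ D.arc e
  | .inr _, .inr _ => False

/-- The associated plane graph of a 1-planar drawing (as an abstract graph): its vertices are
the vertices of `G` (true vertices) and the crossings (false vertices). -/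
def associatedGraph {V : Type*} {G : SimpleGraph V} (D : PlaneDrawing G) :
    SimpleGraph (V ⊕ D.FalseVertex) where
  Adj := D.AssociatedAdj
  symm := ⟨by
    rintro (u | c) (v | d) h
    · refine ⟨h.1.symm, fun f c => ?_⟩
      rw [Sym2.eq_swap]
      exact h.2 f c
    · exact h
    · exact h
    · exact h⟩
  loopless := ⟨by
    rintro (u | c) h
    · exact G.loopless.irrefl u h.1
    · exact h⟩

end PlaneDrawing

/-- A `𝒞₀`-drawing: a 1-planar drawing such that any two false vertices of the
associated plane graph have no common neighbour. -/
def PlaneDrawing.IsC0Drawing {V : Type*} {G : SimpleGraph V} (D : PlaneDrawing G) : Prop :=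
  D.IsOnePlanar ∧ ∀ c₁ c₂ : D.FalseVertex, c₁ ≠ c₂ →
    (D.associatedGraph.neighborSet (.inr c₁) ∩
      D.associatedGraph.neighborSet (.inr c₂)).encard = 0

/-- A graph is of class `𝒞₀` if it has a `𝒞₀`-drawing. -/
def IsClassC0 {V : Type*} (G : SimpleGraph V) : Prop :=
  ∃ D : PlaneDrawing G, D.IsC0Drawing

/-- The join `G + H`: disjoint copies of `G` and `H` together with all edges between them. -/
def joinGraph {V W : Type*} (G : SimpleGraph V) (H : SimpleGraph W) : SimpleGraph (V ⊕ W) :=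
  (G ⊕g H) ⊔ completeBipartiteGraph V W

/-- The (asymmetric) list of edges of the extremal graph. The vertex `a_{i+1}` is `inl i` for
`i < k`, and `b_{i+1}` is `inr i` for `i < k - 1`. In the 1-based labels, the edges are
* `a_i a_{i+1}` and `a_{k-2} a_k`;
* `b_i b_{i+1}`;
* `a_i b_i`, `a_{i+1} b_i`, and `a_{j-1} b_j` for every even `j` with `2 ≤ j ≤ k - 2`. -/
def interlacedRel (k : ℕ) : Fin k ⊕ Fin (k - 1) → Fin k ⊕ Fin (k - 1) → Prop
  | .inl i, .inl j => j.val = i.val + 1 ∨ (i.val + 3 = k ∧ j.val + 1 = k)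
  | .inr i, .inr j => j.val = i.val + 1
  | .inl i, .inr j => i.val = j.val ∨ i.val = j.val + 1 ∨
      (Even (j.val + 1) ∧ j.val + 1 ≤ k - 2 ∧ j.val = i.val + 1)
  | .inr _, .inl _ => False

/-- The extremal graph on the `2k - 1` vertices `a_1, …, a_k, b_1, …, b_{k-1}`. -/
def interlacedPathsGraph (k : ℕ) : SimpleGraph (Fin k ⊕ Fin (k - 1)) :=
  SimpleGraph.fromRel (interlacedRel k)

/-! ### Increments of the logarithm along paths in the complex plane -/

/-! Upper bound. In a `𝒞₀`-drawing every crossing has four true neighbours, and different crossings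
have disjoint sets of neighbours, so there are at most `|V| / 4` crossings. Deleting one edge at
each crossing leaves a graph drawn without crossings, which has at most `3|V| - 6` edges. Hence a
graph of class `𝒞₀` has at most `13|V|/4 - 6` edges (`IsClassC0.four_mul_card_edgeFinset_add_le`).
For `G + P₁` with `|V(G)| = n`, putting `n + 1` for `|V|` and subtracting the `n` edges at the new
vertex gives the claim.

The bound `3|V| - 6` for topological drawings is obtained without faces or Euler's formula. Loose
plane representations survive deletion and contraction, and none exists for `K₅`; a Mader-style
induction then bounds the edges (`IsLoosePlanar.card_edgeFinset_add_six_le`). That `K₅` is excluded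
is a parity count of logarithm increments along its edges (`not_pairwise_disjoint_paths_of_five`).

Tightness. The extremal graph and the new vertex are drawn with straight edges. The path `a_1 …
a_{k-2} a_k` and the path of the `b_i` form the two sides of a parabola, the new vertex lies high
above it, and `a_{k-1}` lies inside, just below the chord from `a_k` to `b_{k-1}`. Only two kinds of
crossings occur: `a_{j-1} b_j` with `a_j b_{j-1}` for even `j`, and the edge from `a_{k-1}` to the
new vertex with `a_k b_{k-1}`. They use pairwise disjoint sets of four vertices. Listing enough
edges bounds the edge count from below, and the first part supplies the reverse inequality. -/

theorem exists_continuous_exp_eq {X : Type*} [TopologicalSpace X] [LocallyPathConnectedSpace X]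
    [SimplyConnectedSpace X] {f : X → ℂ} (hf : Continuous f) (h0 : ∀ x, f x ≠ 0) :
    ∃ g : X → ℂ, Continuous g ∧ ∀ x, Complex.exp (g x) = f x := by
  obtain ⟨x₀⟩ : Nonempty X := inferInstance
  obtain ⟨g, ⟨-, hg⟩, -⟩ := Complex.isCoveringMapOn_exp.existsUnique_continuousMap_lifts
    ⟨f, hf⟩ (a₀ := x₀) (Complex.exp_log (h0 x₀)) h0
  exact ⟨g, g.continuous, fun x => congrFun hg x⟩

/-- `x` is the increment, over the unit interval, of a continuous logarithm of `α - p`. -/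
def IsLogIncrement (α : ℝ → ℂ) (p x : ℂ) : Prop :=
  ∃ g : ℝ → ℂ, Continuous g ∧ (∀ t, Complex.exp (g t) = α t - p) ∧ g 1 - g 0 = x

/-- Two continuous logarithms of the same function differ by `2πi` times a continuous integer-valued
function on `ℝ`, which is constant. -/
theorem IsLogIncrement.unique {α : ℝ → ℂ} {p x y : ℂ} (hx : IsLogIncrement α p x)
    (hy : IsLogIncrement α p y) : x = y := by
  obtain ⟨g, hg, hge, rfl⟩ := hx
  obtain ⟨g', hg', hge', rfl⟩ := hy
  have h : ∀ t, ∃ n : ℤ, g t - g' t = n * (2 * Real.pi * Complex.I) := by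
    intro t
    obtain ⟨n, hn⟩ := Complex.exp_eq_exp_iff_exists_int.1 ((hge t).trans (hge' t).symm)
    exact ⟨n, by rw [hn]; ring⟩
  choose n hn using h
  have hc : Continuous fun t => (n t : ℝ) := by
    have : (fun t => (n t : ℝ)) = fun t => ((g t - g' t) / (2 * Real.pi * Complex.I)).re := by
      ext t
      rw [hn t, mul_div_cancel_right₀ _ Complex.two_pi_I_ne_zero]
      simp
    rw [this]
    fun_prop
  have hn' : Continuous n := by
    rw [Int.isClosedEmbedding_coe_real.isInducing.continuous_iff]
    exact hc
  have := PreconnectedSpace.constant (inferInstance : PreconnectedSpace ℝ) hn' (x := 1) (y := 0)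
  have h1 := hn 1
  rw [this, ← hn 0] at h1
  linear_combination h1

theorem IsLogIncrement.exp_eq {α : ℝ → ℂ} {p x : ℂ} (hx : IsLogIncrement α p x) :
    Complex.exp x = (α 1 - p) / (α 0 - p) := by
  obtain ⟨g, -, hge, rfl⟩ := hx
  rw [Complex.exp_sub, hge, hge]

/-- The increments of the logarithm of two disjoint paths, seen from each other's end points. -/
theorem exists_isLogIncrement_of_disjoint {α β : ℝ → ℂ} (hα : Continuous α) (hβ : Continuous β)
    (h : ∀ s t, α s ≠ β t) :
    ∃ x₀ x₁ y₀ y₁, IsLogIncrement α (β 0) x₀ ∧ IsLogIncrement α (β 1) x₁ ∧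
      IsLogIncrement β (α 0) y₀ ∧ IsLogIncrement β (α 1) y₁ ∧ x₁ - x₀ = y₁ - y₀ := by

  -- One logarithm of `α s - β t` on the whole plane serves both paths. The final identity says that
  -- its increments around the unit square cancel; a shift by `πi` passes from `α s - β t` to `β t -
  -- α s`.
  obtain ⟨Θ, hΘ, he⟩ := exists_continuous_exp_eq (X := ℝ × ℝ) (f := fun z => α z.1 - β z.2)
    (by fun_prop) (fun z => sub_ne_zero.2 (h _ _))
  have hX : ∀ t, IsLogIncrement α (β t) (Θ (1, t) - Θ (0, t)) := fun t =>
    ⟨fun s => Θ (s, t), by fun_prop, fun s => he (s, t), rfl⟩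
  have hY : ∀ s, IsLogIncrement β (α s) (Θ (s, 1) - Θ (s, 0)) := fun s =>
    ⟨fun t => Θ (s, t) + Real.pi * Complex.I, by fun_prop, fun t => by
      rw [Complex.exp_add, he, Complex.exp_pi_mul_I]; ring, by ring⟩
  exact ⟨_, _, _, _, hX 0, hX 1, hY 0, hY 1, by ring⟩

/-- The complete graph on five vertices cannot be mapped to the plane in such a way that
independent edges have disjoint images. -/
theorem not_pairwise_disjoint_paths_of_five (p : Fin 5 → ℂ) (γ : Fin 5 → Fin 5 → ℝ → ℂ)
    (hγ : ∀ i j, i < j → Continuous (γ i j)) (h0 : ∀ i j, i < j → γ i j 0 = p i)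
    (h1 : ∀ i j, i < j → γ i j 1 = p j)
    (hd : ∀ i j k l, i < j → k < l → i ≠ k → i ≠ l → j ≠ k → j ≠ l → ∀ s t, γ i j s ≠ γ k l t) :
    False := by
  have hA : ∀ i j k, ∃ x, i < j → k ≠ i → k ≠ j → IsLogIncrement (γ i j) (p k) x := by
    intro i j k
    by_cases h : i < j ∧ k ≠ i ∧ k ≠ j
    · obtain ⟨hij, hki, hkj⟩ := h
      -- The point `p k` is an end of the edge `kl`, which is independent of `ij`; hence the path of
      -- `ij` avoids `p k` and has a logarithm increment seen from there.
      obtain ⟨l, hli, hlj, hlk⟩ : ∃ l, l ≠ i ∧ l ≠ j ∧ l ≠ k := by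
        revert i j k; decide
      rcases lt_or_gt_of_ne hlk with hlk' | hlk'
      · obtain ⟨-, x, -, -, -, hx, -⟩ := exists_isLogIncrement_of_disjoint (hγ i j hij)
          (hγ l k hlk') (hd i j l k hij hlk' hli.symm hki.symm hlj.symm hkj.symm)
        exact ⟨x, fun _ _ _ => h1 l k hlk' ▸ hx⟩
      · obtain ⟨x, -, -, -, hx, -⟩ := exists_isLogIncrement_of_disjoint (hγ i j hij)
          (hγ k l hlk') (hd i j k l hij hlk' hki.symm hli.symm hkj.symm hlj.symm)
        exact ⟨x, fun _ _ _ => h0 k l hlk' ▸ hx⟩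
    · exact ⟨0, fun a b c => (h ⟨a, b, c⟩).elim⟩
  choose A hA using hA
  have hrel : ∀ i j k l, i < j → k < l → i ≠ k → i ≠ l → j ≠ k → j ≠ l →
      A i j l - A i j k = A k l j - A k l i := by
    intro i j k l hij hkl hik hil hjk hjl
    obtain ⟨x₀, x₁, y₀, y₁, hx₀, hx₁, hy₀, hy₁, h⟩ := exists_isLogIncrement_of_disjoint
      (hγ i j hij) (hγ k l hkl) (hd i j k l hij hkl hik hil hjk hjl)
    rw [h0 k l hkl] at hx₀
    rw [h1 k l hkl] at hx₁
    rw [h0 i j hij] at hy₀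
    rw [h1 i j hij] at hy₁
    rw [(hA i j l hij hil.symm hjl.symm).unique hx₁, (hA i j k hij hik.symm hjk.symm).unique hx₀,
      (hA k l j hkl hjk hjl).unique hy₁, (hA k l i hkl hik hil).unique hy₀, h]
  have hexp : ∀ i j k, i < j → k ≠ i → k ≠ j →
      Complex.exp (A i j k) = (p j - p k) / (p i - p k) := by
    intro i j k hij hki hkj
    rw [(hA i j k hij hki hkj).exp_eq, h0 i j hij, h1 i j hij]
  have hp : ∀ i j, i ≠ j → p i - p j ≠ 0 := by
    intro i j hij
    obtain ⟨k, l, hki, hkj, hli, hlj, hkl⟩ :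
        ∃ k l, k ≠ i ∧ k ≠ j ∧ l ≠ i ∧ l ≠ j ∧ k ≠ l := by
      revert i j; decide
    have key : ∀ a b, a ≠ b → ∃ x y t, x < y ∧ γ x y t = p a ∧ (x = a ∧ y = b ∨ x = b ∧ y = a) := by
      intro a b hab
      rcases lt_or_gt_of_ne hab with h | h
      · exact ⟨a, b, 0, h, h0 a b h, .inl ⟨rfl, rfl⟩⟩
      · exact ⟨b, a, 1, h, h1 b a h, .inr ⟨rfl, rfl⟩⟩
    obtain ⟨x, y, t, hxy, ht, hx⟩ := key i k hki.symm
    obtain ⟨x', y', t', hxy', ht', hx'⟩ := key j l hlj.symm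
    rw [← ht, ← ht']
    refine sub_ne_zero.2 (hd x y x' y' hxy hxy' ?_ ?_ ?_ ?_ t t') <;> grind
  -- The sum of the three angles of a "triangle" is an odd multiple of `π`.
  have hT : ∀ a b c, ∃ m : ℤ, a < b → b < c →
      A a b c + A b c a - A a c b = (2 * m + 1) * (Real.pi * Complex.I) := by
    intro a b c
    by_cases h : a < b ∧ b < c
    · obtain ⟨hab, hbc⟩ := h
      have hac := hab.trans hbc
      have : Complex.exp (A a b c + A b c a - A a c b) = Complex.exp (Real.pi * Complex.I) := by
        rw [Complex.exp_sub, Complex.exp_add, hexp a b c hab hac.ne' hbc.ne',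
          hexp b c a hbc hab.ne hac.ne, hexp a c b hac hab.ne' hbc.ne, Complex.exp_pi_mul_I]
        have h1 := hp a b hab.ne
        have h2 := hp b c hbc.ne
        have h3 := hp a c hac.ne
        have h4 := hp b a hab.ne'
        have h5 := hp c b hbc.ne'
        field_simp
        ring
      obtain ⟨m, hm⟩ := Complex.exp_eq_exp_iff_exists_int.1 this
      exact ⟨m, fun _ _ => by rw [hm]; ring⟩
    · exact ⟨0, fun x y => (h ⟨x, y⟩).elim⟩
  choose m hm using hT
  have hquad : ∀ a b c d, a < b → b < c → c < d →
      ∃ n : ℤ, m a b c + m a b d + m b c d - m a c d + 1 = 2 * n := by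
    intro a b c d hab hbc hcd
    have hac := hab.trans hbc
    have hbd := hbc.trans hcd
    have had := hac.trans hcd
    -- The closed curve `a b c` winds around `p d` an integral number `n` of times. The relations
    -- `hrel` turn this into a parity condition on the four triangles of `a, b, c, d`.
    have : Complex.exp (A a b d + A b c d - A a c d) = 1 := by
      rw [Complex.exp_sub, Complex.exp_add, hexp a b d hab had.ne' hbd.ne',
        hexp b c d hbc hbd.ne' hcd.ne', hexp a c d hac had.ne' hcd.ne']
      have h1 := hp a d had.ne
      have h2 := hp b d hbd.ne
      have h3 := hp c d hcd.ne
      field_simp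
    obtain ⟨n, hn⟩ := Complex.exp_eq_one_iff.1 this
    refine ⟨n, ?_⟩
    have r1 := hrel a b c d hab hcd hac.ne had.ne hbc.ne hbd.ne
    have r2 := hrel a c b d hac hbd hab.ne had.ne hbc.ne' hcd.ne
    have r3 := hrel a d b c had hbc hab.ne hac.ne hbd.ne' hcd.ne'
    have e1 := hm a b c hab hbc
    have e2 := hm a b d hab hbd
    have e3 := hm b c d hbc hcd
    have e4 := hm a c d hac hcd
    have hI : (Real.pi * Complex.I : ℂ) ≠ 0 := by
      simp [Real.pi_ne_zero]
    have : ((m a b c + m a b d + m b c d - m a c d + 1 : ℤ) : ℂ) = ((2 * n : ℤ) : ℂ) := by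
      apply mul_right_cancel₀ hI
      push_cast
      linear_combination (-e1 - e2 - e3 + e4 + 2 * hn - r1 + r2 + r3) / 2
    exact_mod_cast this
  -- For each of the five quadruples the sum of the four `m` is odd, so the total is odd. But every
  -- triple lies in exactly two quadruples, so the total is even.
  obtain ⟨n1, q1⟩ := hquad 0 1 2 3 (by decide) (by decide) (by decide)
  obtain ⟨n2, q2⟩ := hquad 0 1 2 4 (by decide) (by decide) (by decide)
  obtain ⟨n3, q3⟩ := hquad 0 1 3 4 (by decide) (by decide) (by decide)
  obtain ⟨n4, q4⟩ := hquad 0 2 3 4 (by decide) (by decide) (by decide)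
  obtain ⟨n5, q5⟩ := hquad 1 2 3 4 (by decide) (by decide) (by decide)
  omega

/-! ### Loose plane representations of graphs -/

/-- A loose plane representation of the graph `G` with vertex set `S`: vertices are represented by
disjoint path-connected sets, and edges by path-connected sets that meet the sets of their ends
and avoid the sets of all other vertices and of all independent edges. -/
def IsLoosePlanar {V : Type*} (S : Finset V) (G : SimpleGraph V) : Prop :=
  ∃ (B : V → Set (ℝ × ℝ)) (C : V → V → Set (ℝ × ℝ)),
    (∀ v ∈ S, IsPathConnected (B v)) ∧
    (∀ u ∈ S, ∀ v ∈ S, u ≠ v → Disjoint (B u) (B v)) ∧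
    (∀ u v, G.Adj u v → u ∈ S ∧ v ∈ S ∧ IsPathConnected (C u v) ∧
      (B u ∩ C u v).Nonempty ∧ (C u v ∩ B v).Nonempty) ∧
    (∀ u v w, G.Adj u v → w ∈ S → w ≠ u → w ≠ v → Disjoint (C u v) (B w)) ∧
    (∀ u v x y, G.Adj u v → G.Adj x y → u ≠ x → u ≠ y → v ≠ x → v ≠ y →
      Disjoint (C u v) (C x y))

namespace IsLoosePlanar

variable {V : Type*} {S : Finset V} {G : SimpleGraph V}

theorem mem_left (h : IsLoosePlanar S G) {u v : V} (huv : G.Adj u v) : u ∈ S := by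
  obtain ⟨B, C, -, -, hC, -⟩ := h
  exact (hC u v huv).1

theorem mono (h : IsLoosePlanar S G) {T : Finset V} {H : SimpleGraph V} (hTS : T ⊆ S) (hHG : H ≤ G)
    (hT : ∀ u v, H.Adj u v → u ∈ T) : IsLoosePlanar T H := by
  obtain ⟨B, C, h1, h2, h3, h4, h5⟩ := h
  refine ⟨B, C, fun v hv => h1 v (hTS hv), fun u hu v hv => h2 u (hTS hu) v (hTS hv),
    fun u v huv => ⟨hT u v huv, hT v u huv.symm, (h3 u v (hHG huv)).2.2⟩,
    fun u v w huv hw => h4 u v w (hHG huv) (hTS hw),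
    fun u v x y huv hxy => h5 u v x y (hHG huv) (hHG hxy)⟩

/-- The complete graph on five vertices has no loose plane representation. -/
theorem not_injective_of_pairwise_adj (h : IsLoosePlanar S G) (f : Fin 5 → V)
    (hadj : ∀ i j, i < j → G.Adj (f i) (f j)) : False := by
  have hf : ∀ i j, i ≠ j → f i ≠ f j := by
    intro i j hij
    rcases lt_or_gt_of_ne hij with h | h
    · exact (hadj i j h).ne
    · exact (hadj j i h).ne'
  have hS : ∀ i, f i ∈ S := by
    intro i
    by_cases hi : i < 4
    · exact h.mem_left (hadj i 4 hi)
    · exact h.mem_left (hadj 0 i (by omega)).symm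
  obtain ⟨B, C, h1, h2, h3, h4, h5⟩ := h
  choose p hp using fun i => (h1 (f i) (hS i)).nonempty
  -- A path from `p i` to `p j` can be found inside `K i j`, and the sets `K` of independent edges
  -- are disjoint.
  let K : Fin 5 → Fin 5 → Set (ℝ × ℝ) := fun i j => B (f i) ∪ C (f i) (f j) ∪ B (f j)
  have hK : ∀ i j, i < j → IsPathConnected (K i j) := by
    intro i j hij
    obtain ⟨-, -, hc, hn1, hn2⟩ := h3 _ _ (hadj i j hij)
    refine ((h1 _ (hS i)).union hc hn1).union (h1 _ (hS j)) (hn2.mono ?_)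
    exact Set.inter_subset_inter_left _ Set.subset_union_right
  have hγ : ∀ i j, ∃ γ : ℝ → ℝ × ℝ, i < j →
      Continuous γ ∧ γ 0 = p i ∧ γ 1 = p j ∧ ∀ t, γ t ∈ K i j := by
    intro i j
    by_cases hij : i < j
    · obtain ⟨γ, hγ⟩ := (hK i j hij).joinedIn (p i) (.inl (.inl (hp i))) (p j) (.inr (hp j))
      refine ⟨γ.extend, fun _ => ⟨γ.continuous_extend, γ.extend_zero, γ.extend_one, fun t => ?_⟩⟩
      obtain ⟨s, hs⟩ : γ.extend t ∈ Set.range γ := γ.extend_range ▸ Set.mem_range_self t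
      exact hs ▸ hγ s
    · exact ⟨0, fun h => (hij h).elim⟩
  choose γ hγ using hγ
  let e := Complex.equivRealProdCLM.symm
  refine not_pairwise_disjoint_paths_of_five (fun i => e (p i)) (fun i j t => e (γ i j t)) ?_ ?_ ?_ ?_
  · intro i j hij
    exact e.continuous.comp (hγ i j hij).1
  · intro i j hij
    simp only [(hγ i j hij).2.1]
  · intro i j hij
    simp only [(hγ i j hij).2.2.1]
  · intro i j k l hij hkl hik hil hjk hjl s t hst
    have hs := (hγ i j hij).2.2.2 s
    have ht := (hγ k l hkl).2.2.2 t
    rw [e.injective hst] at hs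
    have hBB : ∀ a b, a ≠ b → Disjoint (B (f a)) (B (f b)) := fun a b hab =>
      h2 _ (hS a) _ (hS b) (hf a b hab)
    have hd : Disjoint (K i j) (K k l) := by
      simp only [K, Set.disjoint_union_left, Set.disjoint_union_right]
      have hC1 : ∀ a, a ≠ i → a ≠ j → Disjoint (C (f i) (f j)) (B (f a)) := fun a h h' =>
        h4 _ _ _ (hadj i j hij) (hS a) (hf _ _ h) (hf _ _ h')
      have hC2 : ∀ a, a ≠ k → a ≠ l → Disjoint (C (f k) (f l)) (B (f a)) := fun a h h' =>
        h4 _ _ _ (hadj k l hkl) (hS a) (hf _ _ h) (hf _ _ h')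
      exact ⟨⟨⟨⟨hBB _ _ hik, hC1 _ hik.symm hjk.symm⟩, hBB _ _ hjk⟩,
        ⟨⟨(hC2 _ hik hil).symm, h5 _ _ _ _ (hadj i j hij) (hadj k l hkl) (hf _ _ hik) (hf _ _ hil)
          (hf _ _ hjk) (hf _ _ hjl)⟩, (hC2 _ hjk hjl).symm⟩⟩,
        ⟨⟨hBB _ _ hil, hC1 _ hil.symm hjl.symm⟩, hBB _ _ hjl⟩⟩
    exact Set.disjoint_left.1 hd hs ht

end IsLoosePlanar

/-- The graph obtained from `G` by contracting the vertex `v` into the vertex `u`; the vertex `v`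
becomes isolated. -/
def SimpleGraph.contract {V : Type*} [DecidableEq V] (G : SimpleGraph V) (u v : V) :
    SimpleGraph V where
  Adj x y := x ≠ y ∧ ∃ x' y', G.Adj x' y' ∧ (if x' = v then u else x') = x ∧
    (if y' = v then u else y') = y
  symm := ⟨fun _ _ h => ⟨h.1.symm, by
    obtain ⟨x', y', h1, h2, h3⟩ := h.2
    exact ⟨y', x', h1.symm, h3, h2⟩⟩⟩
  loopless := ⟨fun _ h => h.1 rfl⟩

theorem SimpleGraph.contract_adj_of_ne {V : Type*} [DecidableEq V] {G : SimpleGraph V}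
    {u v x y : V} (h : G.Adj x y) (hx : x ≠ v) (hy : y ≠ v) : (G.contract u v).Adj x y :=
  ⟨h.ne, x, y, h, if_neg hx, if_neg hy⟩

theorem SimpleGraph.contract_adj_left {V : Type*} [DecidableEq V] {G : SimpleGraph V}
    {u v y : V} (h : G.Adj v y) (hy : y ≠ u) : (G.contract u v).Adj u y :=
  ⟨hy.symm, v, y, h, if_pos rfl, if_neg h.ne'⟩

/-- This is why vertices are allowed to be sets: the new vertex is represented by the union of the
sets of `u`, `v` and the edge `uv`, and nothing has to be redrawn. -/
theorem IsLoosePlanar.contract {V : Type*} [DecidableEq V] {S : Finset V} {G : SimpleGraph V}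
    (h : IsLoosePlanar S G) {u v : V} (huv : G.Adj u v) :
    IsLoosePlanar (S.erase v) (G.contract u v) := by
  obtain ⟨B, C, h1, h2, h3, h4, h5⟩ := h
  obtain ⟨hu, hv, hc, hn1, hn2⟩ := h3 u v huv
  have hne := huv.ne
  have hr : ∀ x y, ∃ x' y', (G.contract u v).Adj x y → x ≠ y ∧ G.Adj x' y' ∧
      (if x' = v then u else x') = x ∧ (if y' = v then u else y') = y := by
    intro x y
    by_cases hxy : (G.contract u v).Adj x y
    · obtain ⟨x', y', h⟩ := hxy.2
      exact ⟨x', y', fun _ => ⟨hxy.1, h⟩⟩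
    · exact ⟨x, y, fun h => (hxy h).elim⟩
  -- Each edge of the contracted graph keeps the set of one of the edges of `G` that it comes from.
  -- Independent edges of the contracted graph come from independent edges of `G`.
  choose X Y hXY using hr
  let B' : V → Set (ℝ × ℝ) := fun w => if w = u then B u ∪ C u v ∪ B v else B w
  have hB'u : B' u = B u ∪ C u v ∪ B v := if_pos rfl
  have hB' : ∀ w, w ≠ u → B' w = B w := fun w hw => if_neg hw
  have hsub : ∀ x, B x ⊆ B' (if x = v then u else x) := by
    intro x
    by_cases hx : x = v
    · rw [if_pos hx, hB'u, hx]
      exact Set.subset_union_right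
    · rw [if_neg hx]
      by_cases hxu : x = u
      · rw [hxu, hB'u]
        exact Set.subset_union_left.trans Set.subset_union_left
      · rw [hB' x hxu]
  have hmem : ∀ x ∈ S, (if x = v then u else x) ∈ S.erase v := by
    intro x hx
    by_cases hxv : x = v
    · simp [hxv, hne, hu]
    · simp [hxv, hx]
  refine ⟨B', fun x y => C (X x y) (Y x y), ?_, ?_, ?_, ?_, ?_⟩
  · intro w hw
    obtain ⟨-, hw⟩ := Finset.mem_erase.1 hw
    by_cases hwu : w = u
    · rw [hwu, hB'u]
      exact ((h1 u hu).union hc hn1).union (h1 v hv)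
        (hn2.mono (Set.inter_subset_inter_left _ Set.subset_union_right))
    · rw [hB' w hwu]
      exact h1 w hw
  · have key : ∀ w ∈ S.erase v, w ≠ u → Disjoint (B' u) (B' w) := by
      intro w hw hwu
      obtain ⟨hwv, hw⟩ := Finset.mem_erase.1 hw
      rw [hB'u, hB' w hwu, Set.disjoint_union_left, Set.disjoint_union_left]
      exact ⟨⟨h2 u hu w hw hwu.symm, h4 u v w huv hw hwu hwv⟩, h2 v hv w hw hwv.symm⟩
    intro x hx y hy hxy
    by_cases hxu : x = u
    · rw [hxu]
      exact key y hy (hxu ▸ hxy.symm)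
    · by_cases hyu : y = u
      · rw [hyu]
        exact (key x hx hxu).symm
      · rw [hB' x hxu, hB' y hyu]
        exact h2 x (Finset.mem_of_mem_erase hx) y (Finset.mem_of_mem_erase hy) hxy
  · intro x y hxy
    obtain ⟨-, hadj, hX, hY⟩ := hXY x y hxy
    obtain ⟨hm1, hm2, hc', hn1', hn2'⟩ := h3 _ _ hadj
    refine ⟨hX ▸ hmem _ hm1, hY ▸ hmem _ hm2, hc', ?_, ?_⟩
    · exact hn1'.mono (Set.inter_subset_inter_left _ (by conv_rhs => rw [← hX]
                                                         exact hsub _))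
    · exact hn2'.mono (Set.inter_subset_inter_right _ (by conv_rhs => rw [← hY]
                                                          exact hsub _))
  · intro x y w hxy hw hwx hwy
    obtain ⟨-, hadj, hX, hY⟩ := hXY x y hxy
    obtain ⟨hwv, hw⟩ := Finset.mem_erase.1 hw
    by_cases hwu : w = u
    · rw [hwu, hB'u, Set.disjoint_union_right, Set.disjoint_union_right]
      refine ⟨⟨h4 _ _ _ hadj hu ?_ ?_, h5 _ _ _ _ hadj huv ?_ ?_ ?_ ?_⟩,
        h4 _ _ _ hadj hv ?_ ?_⟩ <;> grind
    · rw [hB' w hwu]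
      refine h4 _ _ _ hadj hw ?_ ?_ <;> grind
  · intro x y z w hxy hzw hxz hxw hyz hyw
    obtain ⟨-, hadj, hX, hY⟩ := hXY x y hxy
    obtain ⟨-, hadj', hX', hY'⟩ := hXY z w hzw
    refine h5 _ _ _ _ hadj hadj' ?_ ?_ ?_ ?_ <;> grind

/-! ### The number of edges of a loosely planar graph -/

namespace SimpleGraph

variable {V : Type*} [Fintype V] [DecidableEq V]

/-- Edges avoiding `v` survive, and an edge from `v` to a vertex outside `u` and its neighbourhood
becomes a new edge at `u`. Only the edge `uv` and one edge per common neighbour can be lost. -/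
theorem card_edgeFinset_le_contract (G : SimpleGraph V) [DecidableRel G.Adj] {u v : V}
    [DecidableRel (G.contract u v).Adj] :
    G.edgeFinset.card ≤ (G.contract u v).edgeFinset.card +
      (G.neighborFinset v ∩ G.neighborFinset u).card + 1 := by
  set N := G.neighborFinset v \ insert u (G.neighborFinset u) with hN
  have hsub : (G.deleteIncidenceSet v).edgeFinset ∪ N.image (fun x => s(u, x)) ⊆
      (G.contract u v).edgeFinset := by
    intro e he
    rw [mem_edgeFinset]
    rcases Finset.mem_union.1 he with he | he
    · induction e with | _ x y
      rw [mem_edgeFinset, mem_edgeSet, deleteIncidenceSet_adj] at he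
      exact contract_adj_of_ne he.1 he.2.1 he.2.2
    · obtain ⟨x, hx, rfl⟩ := Finset.mem_image.1 he
      simp only [hN, Finset.mem_sdiff, mem_neighborFinset, Finset.mem_insert, not_or] at hx
      exact contract_adj_left hx.1 hx.2.1
  have hdisj : Disjoint (G.deleteIncidenceSet v).edgeFinset (N.image (fun x => s(u, x))) := by
    rw [Finset.disjoint_left]
    intro e he he'
    obtain ⟨x, hx, rfl⟩ := Finset.mem_image.1 he'
    simp only [hN, Finset.mem_sdiff, mem_neighborFinset, Finset.mem_insert, not_or] at hx
    rw [mem_edgeFinset, mem_edgeSet, deleteIncidenceSet_adj] at he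
    exact hx.2.2 he.1
  have hcard := Finset.card_le_card hsub
  rw [Finset.card_union_of_disjoint hdisj, card_edgeFinset_deleteIncidenceSet,
    Finset.card_image_of_injective N (fun x y h => Sym2.congr_right.1 h)] at hcard
  have h1 := Finset.card_sdiff_add_card_inter (G.neighborFinset v)
    (insert u (G.neighborFinset u))
  rw [card_neighborFinset_eq_degree, ← hN] at h1
  have h2 : (G.neighborFinset v ∩ insert u (G.neighborFinset u)).card ≤
      (G.neighborFinset v ∩ G.neighborFinset u).card + 1 := by
    refine (Finset.card_le_card ?_).trans (Finset.card_insert_le u _)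
    intro x hx
    simp only [Finset.mem_inter, Finset.mem_insert] at hx ⊢
    tauto
  have h3 : G.degree v ≤ G.edgeFinset.card :=
    G.degree_le_card_edgeFinset v
  omega

theorem exists_le_card_edgeFinset_eq (G : SimpleGraph V) [DecidableRel G.Adj] {n : ℕ}
    (hn : n ≤ G.edgeFinset.card) :
    ∃ (H : SimpleGraph V) (_ : DecidableRel H.Adj), H ≤ G ∧ H.edgeFinset.card = n := by
  obtain ⟨T, hT, hTn⟩ := Finset.exists_subset_card_eq hn
  have hTG : (T : Set (Sym2 V)) ⊆ G.edgeSet := fun e he => mem_edgeFinset.1 (hT he)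
  have hle : fromEdgeSet (T : Set (Sym2 V)) ≤ G := by
    rw [← fromEdgeSet_edgeSet G]
    exact fromEdgeSet_mono hTG
  refine ⟨fromEdgeSet T, inferInstance, hle, ?_⟩
  rw [← hTn]
  congr 1
  ext e
  simp only [edgeFinset, Set.mem_toFinset, edgeSet_fromEdgeSet]
  exact ⟨fun h => h.1, fun h => ⟨h, G.not_isDiag_of_mem_edgeSet (hTG h)⟩⟩

end SimpleGraph

namespace IsLoosePlanar

open Finset

variable {V : Type*} [Fintype V] {S : Finset V} {G : SimpleGraph V}
  [DecidableRel G.Adj]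

theorem sum_degrees (h : IsLoosePlanar S G) : ∑ v ∈ S, G.degree v = 2 * G.edgeFinset.card := by
  rw [← G.sum_degrees_eq_twice_card_edges]
  refine Finset.sum_subset (Finset.subset_univ S) fun v _ hv => ?_
  rw [SimpleGraph.degree_eq_zero]
  intro w hw
  exact hv (h.mem_left hw)

theorem degree_lt_card (h : IsLoosePlanar S G) {v : V} (hv : v ∈ S) : G.degree v < S.card := by
  rw [← G.card_neighborFinset_eq_degree]
  refine Finset.card_lt_card ⟨fun w hw => ?_, fun hs => ?_⟩
  · exact h.mem_left ((G.mem_neighborFinset v w).1 hw).symm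
  · exact G.loopless.irrefl v ((G.mem_neighborFinset v v).1 (hs hv))

/-- A vertex of degree four or five cannot have only neighbours that share at least three
neighbours with it. -/
theorem exists_card_common_neighbors_le [DecidableEq V] (h : IsLoosePlanar S G) {v : V} (h4 : 4 ≤ G.degree v)
    (h5 : G.degree v ≤ 5) :
    ∃ u, G.Adj u v ∧ (G.neighborFinset v ∩ G.neighborFinset u).card ≤ 2 := by
  by_contra! hcon
  set N := G.neighborFinset v with hN
  have hNv : ∀ x, x ∈ N ↔ G.Adj v x := fun x => G.mem_neighborFinset v x
  have hcard : N.card = G.degree v := G.card_neighborFinset_eq_degree v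
  -- Under the contrary assumption, a neighbour of `v` misses no other neighbour of `v` if the
  -- degree is four, and at most one if it is five.
  have hnon : ∀ x ∈ N, (N.filter fun y => ¬ (y = x ∨ G.Adj x y)).card + 4 ≤ G.degree v := by
    intro x hx
    have h1 := Finset.card_filter_add_card_filter_not (s := N) (fun y => y = x ∨ G.Adj x y)
    have h2 : insert x (N ∩ G.neighborFinset x) ⊆ N.filter (fun y => y = x ∨ G.Adj x y) := by
      intro y hy
      simp only [mem_insert, mem_inter, SimpleGraph.mem_neighborFinset] at hy
      grind
    have h3 := Finset.card_le_card h2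
    rw [Finset.card_insert_of_notMem (by simp)] at h3
    have h4 := hcon x ((hNv x).1 hx).symm
    omega
  -- A non-adjacent pair has this property, since neither end can miss a further vertex; if there is
  -- none, any pair will do.
  obtain ⟨a, ha, a', ha', haa, hadj⟩ : ∃ a ∈ N, ∃ a' ∈ N, a ≠ a' ∧
      ∀ y ∈ N, y ≠ a → y ≠ a' → G.Adj a y ∧ G.Adj a' y := by
    by_cases hex : ∃ a ∈ N, ∃ a' ∈ N, a ≠ a' ∧ ¬ G.Adj a a'
    · obtain ⟨a, ha, a', ha', haa, hna⟩ := hex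
      refine ⟨a, ha, a', ha', haa, ?_⟩
      have key : ∀ b ∈ N, ∀ b' ∈ N, b ≠ b' → ¬ G.Adj b b' → ∀ y ∈ N, y ≠ b → y ≠ b' →
          G.Adj b y := by
        intro b hb b' hb' hbb hnb y hy hyb hyb'
        by_contra hny
        have h1 := hnon b hb
        have h2 : ({b', y} : Finset V) ⊆ N.filter fun y => ¬ (y = b ∨ G.Adj b y) := by
          intro z hz
          simp only [mem_insert, mem_singleton] at hz
          grind
        have h3 := Finset.card_le_card h2
        rw [Finset.card_pair hyb'.symm] at h3
        omega
      exact fun y hy hya hya' => ⟨key a ha a' ha' haa hna y hy hya hya',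
        key a' ha' a ha haa.symm (fun h => hna h.symm) y hy hya' hya⟩
    · push Not at hex
      obtain ⟨a, ha, a', ha', haa⟩ := Finset.one_lt_card.1 (show 1 < N.card by omega)
      exact ⟨a, ha, a', ha', haa, fun y hy hya hya' =>
        ⟨hex a ha y hy hya.symm, hex a' ha' y hy hya'.symm⟩⟩
  have hM : ∀ y ∈ (N.erase a).erase a', G.Adj v y ∧ y ≠ a ∧ y ≠ a' ∧ G.Adj a y ∧ G.Adj a' y := by
    intro y hy
    simp only [mem_erase] at hy
    obtain ⟨h1, h2, h3⟩ := hy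
    exact ⟨(hNv y).1 h3, h2, h1, hadj y h3 h2 h1⟩
  have hMcard : ((N.erase a).erase a').card + 2 = G.degree v := by
    rw [Finset.card_erase_of_mem (mem_erase.2 ⟨haa.symm, ha'⟩), Finset.card_erase_of_mem ha]
    omega
  have hva := (hNv a).1 ha
  have hva' := (hNv a').1 ha'
  rcases Nat.lt_or_ge (G.degree v) 5 with hlt | hge
  · have hall : ∀ x ∈ N, ∀ y ∈ N, x ≠ y → G.Adj x y := by
      intro x hx y hy hxy
      by_contra hn
      have h1 := hnon x hx
      have h2 : 0 < (N.filter fun y => ¬ (y = x ∨ G.Adj x y)).card :=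
        Finset.card_pos.2 ⟨y, by simp [hy, hn, hxy.symm]⟩
      omega
    obtain ⟨x, y, hxy, hxyM⟩ := Finset.card_eq_two.1 (show ((N.erase a).erase a').card = 2 by omega)
    obtain ⟨hvx, hxa, hxa', hax, ha'x⟩ := hM x (by simp [hxyM])
    obtain ⟨hvy, hya, hya', hay, ha'y⟩ := hM y (by simp [hxyM])
    have haa'' := hall a ha a' ha' haa
    have hxy' := hall x ((hNv x).2 hvx) y ((hNv y).2 hvy) hxy
    refine h.not_injective_of_pairwise_adj ![v, a, a', x, y] ?_
    intro i j hij
    fin_cases i <;> fin_cases j <;> first | exact absurd hij (by decide) | assumption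
  -- Degree five: contracting a third vertex `b` into `a` makes `a` and `a'` adjacent, so an edge
  -- `xy` among the other two completes a `K₅` on `v, a, a', x, y`.
  · have key : ∀ x ∈ (N.erase a).erase a', ∀ y ∈ (N.erase a).erase a',
        ∀ b ∈ (N.erase a).erase a', x ≠ b → y ≠ b → G.Adj x y → False := by
      intro x hx y hy b hb hxb hyb hxy
      obtain ⟨hvx, hxa, hxa', hax, ha'x⟩ := hM x hx
      obtain ⟨hvy, hya, hya', hay, ha'y⟩ := hM y hy
      obtain ⟨hvb, hba, hba', hab, ha'b⟩ := hM b hb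
      have hc : ∀ {p q : V}, G.Adj p q → p ≠ b → q ≠ b → (G.contract a b).Adj p q :=
        fun h hp hq => SimpleGraph.contract_adj_of_ne h hp hq
      have e1 := hc hva hvb.ne hba.symm
      have e2 := hc hva' hvb.ne hba'.symm
      have e3 := hc hvx hvb.ne hxb
      have e4 := hc hvy hvb.ne hyb
      have e5 : (G.contract a b).Adj a a' := SimpleGraph.contract_adj_left ha'b.symm haa.symm
      have e6 := hc hax hba.symm hxb
      have e7 := hc hay hba.symm hyb
      have e8 := hc ha'x hba'.symm hxb
      have e9 := hc ha'y hba'.symm hyb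
      have e10 := hc hxy hxb hyb
      refine (h.contract hab).not_injective_of_pairwise_adj ![v, a, a', x, y] ?_
      intro i j hij
      fin_cases i <;> fin_cases j <;> first | exact absurd hij (by decide) | assumption
    obtain ⟨x, y, z, hxy, hxz, hyz, hM3⟩ :=
      Finset.card_eq_three.1 (show ((N.erase a).erase a').card = 3 by omega)
    have hx : x ∈ (N.erase a).erase a' := by simp [hM3]
    have hy : y ∈ (N.erase a).erase a' := by simp [hM3]
    have hz : z ∈ (N.erase a).erase a' := by simp [hM3]
    by_cases hadj' : G.Adj x y
    · exact key x hx y hy z hz hxz hyz hadj'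
    · by_cases hadj'' : G.Adj x z
      · exact key x hx z hz y hy hxy hyz.symm hadj''
      · have hxN : x ∈ N := Finset.mem_of_mem_erase (Finset.mem_of_mem_erase hx)
        have h1 := hnon x hxN
        have h2 : ({y, z} : Finset V) ⊆ N.filter fun w => ¬ (w = x ∨ G.Adj x w) := by
          intro w hw
          simp only [mem_insert, mem_singleton] at hw
          have hyN : y ∈ N := Finset.mem_of_mem_erase (Finset.mem_of_mem_erase hy)
          have hzN : z ∈ N := Finset.mem_of_mem_erase (Finset.mem_of_mem_erase hz)
          grind
        have h3 := Finset.card_le_card h2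
        rw [Finset.card_pair hyz] at h3
        omega

end IsLoosePlanar

/-- Euler's bound on the number of edges. -/
theorem IsLoosePlanar.card_edgeFinset_add_six_le {V : Type*} [Fintype V] {S : Finset V}
    {G : SimpleGraph V} [DecidableRel G.Adj] (h : IsLoosePlanar S G) (hS : 3 ≤ S.card) :
    G.edgeFinset.card + 6 ≤ 3 * S.card := by
  classical
  obtain ⟨n, hn⟩ : ∃ n, S.card = n + 3 := ⟨S.card - 3, by omega⟩
  induction n generalizing S G with
  | zero =>
    have h1 := h.sum_degrees
    have h2 := Finset.sum_le_card_nsmul S (fun v => G.degree v) 2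
      (fun v hv => by have := h.degree_lt_card hv; omega)
    simp only [smul_eq_mul] at h2
    omega
  | succ n ih =>
    by_contra hcon
    -- With `n + 4` vertices, `3n + 7` is one edge too many. Trimming to exactly this number keeps
    -- the average degree below six, so some vertex has degree at most five; removing it by deletion
    -- or contraction then costs at most three edges.
    obtain ⟨H, hdec, hHG, hH⟩ := G.exists_le_card_edgeFinset_eq (n := 3 * n + 7) (by omega)
    have hHS : IsLoosePlanar S H := h.mono subset_rfl hHG fun u v huv => h.mem_left (hHG huv)
    have h1 := hHS.sum_degrees
    obtain ⟨v, hv, hdeg⟩ : ∃ v ∈ S, H.degree v ≤ 5 := by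
      by_contra! hd
      have := Finset.card_nsmul_le_sum S (fun v => H.degree v) 6 (fun v hv => hd v hv)
      simp only [smul_eq_mul] at this
      omega
    have hcard : (S.erase v).card = n + 3 := by
      rw [Finset.card_erase_of_mem hv]
      omega
    rcases Nat.lt_or_ge (H.degree v) 4 with hlt | hge
    · have hdel : IsLoosePlanar (S.erase v) (H.deleteIncidenceSet v) := by
        refine hHS.mono (Finset.erase_subset v S) (H.deleteIncidenceSet_le v) fun x y hxy => ?_
        rw [SimpleGraph.deleteIncidenceSet_adj] at hxy
        exact Finset.mem_erase.2 ⟨hxy.2.1, hHS.mem_left hxy.1⟩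
      have := ih hdel (by omega) hcard
      rw [SimpleGraph.card_edgeFinset_deleteIncidenceSet] at this
      omega
    · obtain ⟨u, huv, hcom⟩ := hHS.exists_card_common_neighbors_le hge hdeg
      have h2 := ih (hHS.contract huv) (by omega) hcard
      have h3 := H.card_edgeFinset_le_contract (u := u) (v := v)
      omega

/-! ### The number of edges of a graph of class `𝒞₀` -/

theorem IsSimpleArc.isPathConnected {A : Set (ℝ × ℝ)} {p q : ℝ × ℝ} (h : IsSimpleArc A p q) :
    IsPathConnected A := by
  obtain ⟨γ, -, rfl⟩ := h
  have : PathConnectedSpace unitInterval := isPathConnected_iff_pathConnectedSpace.1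
    ((convex_Icc (0 : ℝ) 1).isPathConnected ⟨0, by simp⟩)
  exact isPathConnected_range γ.continuous

theorem IsSimpleArc.left_mem {A : Set (ℝ × ℝ)} {p q : ℝ × ℝ} (h : IsSimpleArc A p q) : p ∈ A := by
  obtain ⟨γ, -, rfl⟩ := h
  exact ⟨0, γ.source⟩

theorem IsSimpleArc.right_mem {A : Set (ℝ × ℝ)} {p q : ℝ × ℝ} (h : IsSimpleArc A p q) :
    q ∈ A := by
  obtain ⟨γ, -, rfl⟩ := h
  exact ⟨1, γ.target⟩

namespace PlaneDrawing

variable {V : Type*} {G : SimpleGraph V} (D : PlaneDrawing G)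

theorem Crosses.symm {D : PlaneDrawing G} {e f : Sym2 V} {c : ℝ × ℝ} (h : D.Crosses e f c) :
    D.Crosses f e c :=
  ⟨h.2.1, h.1, h.2.2.1.symm, h.2.2.2.2.1, h.2.2.2.1, h.2.2.2.2.2⟩

/-- Adjacent edges meet only in a vertex, and a crossing is not a vertex. So two crossing edges have
four distinct ends. -/
theorem Crosses.notMem {D : PlaneDrawing G} {e f : Sym2 V} {c : ℝ × ℝ} (h : D.Crosses e f c)
    {w : V} (he : w ∈ e) : w ∉ f := by
  intro hf
  obtain ⟨he1, hf1, hne, hce, hcf, hc⟩ := h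
  obtain ⟨a, rfl⟩ := he
  obtain ⟨b, rfl⟩ := hf
  have hab : a ≠ b := fun h => hne (by rw [h])
  have hm := D.adjacent_meet w a b he1 hf1 hab
  have : c ∈ ({D.pos w} : Set (ℝ × ℝ)) := hm ▸ ⟨hce, hcf⟩
  exact hc ⟨w, this.symm⟩

/-- Independent edges that do not cross are disjoint. -/
theorem crosses_of_mem_inter {e f : Sym2 V} (he : e ∈ G.edgeSet) (hf : f ∈ G.edgeSet)
    (h : ∀ w ∈ e, w ∉ f) {c : ℝ × ℝ} (hce : c ∈ D.arc e) (hcf : c ∈ D.arc f) :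
    D.Crosses e f c := by
  refine ⟨he, hf, ?_, hce, hcf, ?_⟩
  · rintro rfl
    induction e with | _ x y
    exact h x (Sym2.mem_mk_left x y) (Sym2.mem_mk_left x y)
  · rintro ⟨w, rfl⟩
    exact h w (D.mem_of_pos_mem e he w hce) (D.mem_of_pos_mem f hf w hcf)

/-- A subgraph in whose drawing no two edges cross is loosely planar. -/
theorem isLoosePlanar_of_not_crosses [Fintype V] {H : SimpleGraph V} (hHG : H ≤ G)
    (h : ∀ e ∈ H.edgeSet, ∀ f ∈ H.edgeSet, ∀ c, ¬ D.Crosses e f c) :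
    IsLoosePlanar Finset.univ H := by
  refine ⟨fun v => {D.pos v}, fun u v => D.arc s(u, v), fun v _ => isPathConnected_singleton _,
    fun u _ v _ huv => ?_, fun u v huv => ?_, fun u v w huv _ hwu hwv => ?_,
    fun u v x y huv hxy hux huy hvx hvy => ?_⟩
  · exact Set.disjoint_singleton.2 fun h => huv (D.pos_injective h)
  · have ha := D.isSimpleArc u v (hHG huv)
    exact ⟨Finset.mem_univ u, Finset.mem_univ v, ha.isPathConnected,
      ⟨_, rfl, ha.left_mem⟩, ⟨_, ha.right_mem, rfl⟩⟩
  · refine Set.disjoint_singleton_right.2 fun hw => ?_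
    rcases Sym2.mem_iff.1 (D.mem_of_pos_mem _ (hHG huv) w hw) with h | h
    exacts [hwu h, hwv h]
  · refine Set.disjoint_left.2 fun c hc hc' => h s(u, v) huv s(x, y) hxy c ?_
    refine D.crosses_of_mem_inter (hHG huv) (hHG hxy) (fun w hw => ?_) hc hc'
    rcases Sym2.mem_iff.1 hw with rfl | rfl <;> simp [*]

end PlaneDrawing

theorem IsClassC0.four_mul_card_edgeFinset_add_le {V : Type*} [Fintype V] {G : SimpleGraph V}
    [DecidableRel G.Adj] (h : IsClassC0 G) (hV : 3 ≤ Fintype.card V) :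
    4 * G.edgeFinset.card + 24 ≤ 13 * Fintype.card V := by
  classical
  obtain ⟨D, h1, h0⟩ := h
  choose e f hef using fun c : D.FalseVertex => c.2
  have hnbr : ∀ c c' : D.FalseVertex, c ≠ c' → ∀ g ∈ G.edgeSet, ∀ g' ∈ G.edgeSet,
      c.1 ∈ D.arc g → c'.1 ∈ D.arc g' → ∀ w, w ∈ g → w ∉ g' := by
    intro c c' hcc g hg g' hg' hc hc' w hw hw'
    have := h0 c c' hcc
    rw [Set.encard_eq_zero] at this
    refine Set.notMem_empty (Sum.inl w : V ⊕ D.FalseVertex) ?_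
    rw [← this]
    exact ⟨⟨g, hg, hw, hc⟩, ⟨g', hg', hw', hc'⟩⟩
  -- Finiteness of the set of crossings is not part of the definition of a drawing; it follows
  -- because each crossing determines its own edge.
  have he_inj : Function.Injective e := by
    intro c c' hcc
    by_contra hne
    obtain ⟨w, hw⟩ : ∃ w, w ∈ e c := by
      induction e c with | _ x y
      exact ⟨x, Sym2.mem_mk_left x y⟩
    exact hnbr c c' hne _ (hef c).1 _ (hef c').1 (hef c).2.2.2.1 (hef c').2.2.2.1 w hw (hcc ▸ hw)
  have : Finite D.FalseVertex := Finite.of_injective e he_inj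
  have : Fintype D.FalseVertex := Fintype.ofFinite _
  have hcard4 : ∀ c, ((e c).toFinset ∪ (f c).toFinset).card = 4 := by
    intro c
    rw [Finset.card_union_of_disjoint, Sym2.card_toFinset_of_not_isDiag,
      Sym2.card_toFinset_of_not_isDiag]
    · exact G.not_isDiag_of_mem_edgeSet (hef c).2.1
    · exact G.not_isDiag_of_mem_edgeSet (hef c).1
    · rw [Finset.disjoint_left]
      intro w hw hw'
      exact (hef c).notMem (Sym2.mem_toFinset.1 hw) (Sym2.mem_toFinset.1 hw')
  have hX : 4 * Fintype.card D.FalseVertex ≤ Fintype.card V := by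
    have := Finset.card_biUnion (s := Finset.univ) (t := fun c => (e c).toFinset ∪ (f c).toFinset)
      (by
        intro c _ c' _ hcc
        simp only [Function.onFun]
        rw [Finset.disjoint_left]
        intro w hw hw'
        simp only [Finset.mem_union, Sym2.mem_toFinset] at hw hw'
        have ha := hnbr c c' hcc
        rcases hw with hw | hw <;> rcases hw' with hw' | hw'
        · exact ha _ (hef c).1 _ (hef c').1 (hef c).2.2.2.1 (hef c').2.2.2.1 w hw hw'
        · exact ha _ (hef c).1 _ (hef c').2.1 (hef c).2.2.2.1 (hef c').2.2.2.2.1 w hw hw'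
        · exact ha _ (hef c).2.1 _ (hef c').1 (hef c).2.2.2.2.1 (hef c').2.2.2.1 w hw hw'
        · exact ha _ (hef c).2.1 _ (hef c').2.1 (hef c).2.2.2.2.1 (hef c').2.2.2.2.1 w hw hw')
    simp only [hcard4, Finset.sum_const, Finset.card_univ, smul_eq_mul] at this
    have := Finset.card_le_univ (Finset.univ.biUnion fun c => (e c).toFinset ∪ (f c).toFinset)
    omega
  let H := G.deleteEdges (Set.range e)
  have hmem : ∀ g ∈ H.edgeSet, g ∈ G.edgeSet ∧ g ∉ Set.range e := by
    intro g hg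
    rw [SimpleGraph.edgeSet_deleteEdges] at hg
    exact hg
  have hloose : IsLoosePlanar Finset.univ H := by
    refine D.isLoosePlanar_of_not_crosses (SimpleGraph.deleteEdges_le _) fun g hg g' hg' c hc => ?_
    let x : D.FalseVertex := ⟨c, g, g', hc⟩
    have hx := hef x
    have hg1 : g ≠ e x := fun h => (hmem g hg).2 ⟨x, h.symm⟩
    have hg2 : g' ≠ e x := fun h => (hmem g' hg').2 ⟨x, h.symm⟩
    -- If `g` and `g'` still crossed at `c`, the deleted edge `e x` through `c` would be a second
    -- edge crossing `g`, contrary to 1-planarity.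
    have hc' : D.Crosses g (e x) c :=
      ⟨hc.1, hx.1, hg1, hc.2.2.2.1, hx.2.2.2.1, hc.2.2.2.2.2⟩
    exact hg2 (h1 _ _ _ _ _ hc hc').1
  have hbound := hloose.card_edgeFinset_add_six_le (by rwa [Finset.card_univ])
  rw [Finset.card_univ] at hbound
  have hsub : G.edgeFinset ⊆ H.edgeFinset ∪ Finset.univ.image e := by
    intro g hg
    rw [SimpleGraph.mem_edgeFinset] at hg
    by_cases hr : g ∈ Set.range e
    · obtain ⟨c, rfl⟩ := hr
      exact Finset.mem_union_right _ (Finset.mem_image_of_mem e (Finset.mem_univ c))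
    · refine Finset.mem_union_left _ (SimpleGraph.mem_edgeFinset.2 ?_)
      rw [SimpleGraph.edgeSet_deleteEdges]
      exact ⟨hg, hr⟩
  have hle := (Finset.card_le_card hsub).trans (Finset.card_union_le _ _)
  have him : (Finset.univ.image e).card ≤ Fintype.card D.FalseVertex := Finset.card_image_le
  omega

theorem card_edgeFinset_add_card_le_joinGraph {V : Type*} [Fintype V] (G : SimpleGraph V)
    [DecidableRel G.Adj] [DecidableRel (joinGraph G (SimpleGraph.pathGraph 1)).Adj] :
    G.edgeFinset.card + Fintype.card V ≤
      (joinGraph G (SimpleGraph.pathGraph 1)).edgeFinset.card := by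
  classical
  have hi1 : Function.Injective (Sym2.map (Sum.inl : V → V ⊕ Fin 1)) :=
    Sym2.map.injective Sum.inl_injective
  have hi2 : Function.Injective fun v : V => (s(Sum.inl v, Sum.inr 0) : Sym2 (V ⊕ Fin 1)) := by
    intro v w h
    simpa using h
  rw [← Finset.card_image_of_injective _ hi1, ← Finset.card_univ,
    ← Finset.card_image_of_injective _ hi2, ← Finset.card_union_of_disjoint]
  · refine Finset.card_le_card fun g hg => ?_
    rw [SimpleGraph.mem_edgeFinset]
    rcases Finset.mem_union.1 hg with hg | hg
    · obtain ⟨g', hg', rfl⟩ := Finset.mem_image.1 hg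
      induction g' with | _ x y
      rw [SimpleGraph.mem_edgeFinset, SimpleGraph.mem_edgeSet] at hg'
      simp [joinGraph, hg']
    · obtain ⟨v, -, rfl⟩ := Finset.mem_image.1 hg
      simp [joinGraph]
  · rw [Finset.disjoint_left]
    intro g hg hg'
    obtain ⟨g', -, rfl⟩ := Finset.mem_image.1 hg
    obtain ⟨v, -, hv⟩ := Finset.mem_image.1 hg'
    induction g' with | _ x y
    simp at hv

theorem IsClassC0.four_mul_ncard_edgeSet_add_le {V : Type*} [Finite V] {G : SimpleGraph V}
    (h : IsClassC0 (joinGraph G (SimpleGraph.pathGraph 1))) (hV : 2 ≤ Nat.card V) :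
    4 * G.edgeSet.ncard + 11 ≤ 9 * Nat.card V := by
  classical
  have := Fintype.ofFinite V
  rw [Nat.card_eq_fintype_card] at hV ⊢
  have h1 := h.four_mul_card_edgeFinset_add_le (by simp; omega)
  have h2 := card_edgeFinset_add_card_le_joinGraph G
  rw [Set.ncard_eq_toFinset_card']
  change 4 * G.edgeFinset.card + 11 ≤ _
  simp only [Fintype.card_sum, Fintype.card_fin] at h1
  omega

/-! ### Straight-line drawings of points in general position -/

/-- Twice the signed area of the triangle `a b c`. -/
def signedArea (a b c : ℝ × ℝ) : ℝ := (b.1 - a.1) * (c.2 - a.2) - (b.2 - a.2) * (c.1 - a.1)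

theorem mem_segment_prod_iff {a b x : ℝ × ℝ} :
    x ∈ segment ℝ a b ↔ ∃ t : ℝ, 0 ≤ t ∧ t ≤ 1 ∧ x.1 = a.1 + t * (b.1 - a.1) ∧
      x.2 = a.2 + t * (b.2 - a.2) := by
  rw [segment_eq_image', Set.mem_image]
  constructor
  · rintro ⟨t, ht, rfl⟩
    exact ⟨t, ht.1, ht.2, by simp, by simp⟩
  · rintro ⟨t, h0, h1, hx, hy⟩
    exact ⟨t, ⟨h0, h1⟩, Prod.ext (by simp [hx]) (by simp [hy])⟩

theorem isSimpleArc_segment {a b : ℝ × ℝ} (h : a ≠ b) : IsSimpleArc (segment ℝ a b) a b := by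
  refine ⟨⟨⟨fun t : unitInterval => AffineMap.lineMap a b (t : ℝ), by fun_prop⟩, by simp, by simp⟩,
    fun s t hst => Subtype.ext (AffineMap.lineMap_injective ℝ h hst), ?_⟩
  rw [segment_eq_image_lineMap]
  ext x
  simp [Set.mem_image]

/-- Segments of different directions that share an inner point cross there. -/
theorem crossProperlyAt_segment {a b p q c : ℝ × ℝ} {s t : ℝ} (hs : 0 < s) (hs' : s < 1)
    (ht : 0 < t) (ht' : t < 1) (h1 : c.1 = a.1 + s * (b.1 - a.1)) (h2 : c.2 = a.2 + s * (b.2 - a.2))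
    (h3 : c.1 = p.1 + t * (q.1 - p.1)) (h4 : c.2 = p.2 + t * (q.2 - p.2))
    (hD : (b.1 - a.1) * (q.2 - p.2) - (b.2 - a.2) * (q.1 - p.1) ≠ 0) :
    CrossProperlyAt (segment ℝ a b) (segment ℝ p q) c := by
  set D := (b.1 - a.1) * (q.2 - p.2) - (b.2 - a.2) * (q.1 - p.1) with hDdef
  -- Affine coordinates with origin `c`: the first along `q - p`, the second along `b - a`, computed
  -- by Cramer's rule. They are later restricted to the set `U` where neither segment has reached an
  -- end.
  let φ : (ℝ × ℝ) ≃ₜ (ℝ × ℝ) :=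
    { toFun := fun x => (((b.1 - a.1) * (x.2 - c.2) - (b.2 - a.2) * (x.1 - c.1)) / D,
        ((x.1 - c.1) * (q.2 - p.2) - (x.2 - c.2) * (q.1 - p.1)) / D)
      invFun := fun z => (c.1 + z.2 * (b.1 - a.1) + z.1 * (q.1 - p.1),
        c.2 + z.2 * (b.2 - a.2) + z.1 * (q.2 - p.2))
      left_inv := by
        intro x
        ext
        · field_simp
          rw [hDdef]
          ring
        · field_simp
          rw [hDdef]
          ring
      right_inv := by
        intro z
        ext
        · field_simp
          rw [hDdef]
          ring
        · field_simp
          rw [hDdef]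
          ring
      continuous_toFun := by fun_prop
      continuous_invFun := by fun_prop }
  have hinv : ∀ x, x.1 = c.1 + (φ x).2 * (b.1 - a.1) + (φ x).1 * (q.1 - p.1) ∧
      x.2 = c.2 + (φ x).2 * (b.2 - a.2) + (φ x).1 * (q.2 - p.2) := by
    intro x
    have := φ.symm_apply_apply x
    exact ⟨(congrArg Prod.fst this).symm, (congrArg Prod.snd this).symm⟩
  have hφ1 : ∀ x, (φ x).1 = ((b.1 - a.1) * (x.2 - c.2) - (b.2 - a.2) * (x.1 - c.1)) / D :=
    fun _ => rfl
  have hφ2 : ∀ x, (φ x).2 = ((x.1 - c.1) * (q.2 - p.2) - (x.2 - c.2) * (q.1 - p.1)) / D :=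
    fun _ => rfl
  let U : Set (ℝ × ℝ) := {x | -s < (φ x).2 ∧ (φ x).2 < 1 - s ∧ -t < (φ x).1 ∧ (φ x).1 < 1 - t}
  have hU : IsOpen U := by
    have h1 : Continuous fun x => (φ x).1 := by fun_prop
    have h2 : Continuous fun x => (φ x).2 := by fun_prop
    exact (isOpen_lt continuous_const h2).inter ((isOpen_lt h2 continuous_const).inter
      ((isOpen_lt continuous_const h1).inter (isOpen_lt h1 continuous_const)))
  have hφc : φ c = (0, 0) := by
    ext
    · rw [hφ1]; simp
    · rw [hφ2]; simp
  refine ⟨φ.toOpenPartialHomeomorph.restrOpen U hU, ?_, hφc, ?_⟩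
  · simp only [OpenPartialHomeomorph.restrOpen_source, Homeomorph.toOpenPartialHomeomorph_source,
      Set.univ_inter]
    refine ⟨?_, ?_, ?_, ?_⟩ <;> rw [hφc] <;> simp [hs, hs', ht, ht']
  · intro x hx
    simp only [OpenPartialHomeomorph.restrOpen_source, Homeomorph.toOpenPartialHomeomorph_source,
      Set.univ_inter] at hx
    obtain ⟨hx1, hx2, hx3, hx4⟩ := hx
    change (_ ↔ (φ x).1 = 0) ∧ (_ ↔ (φ x).2 = 0)
    obtain ⟨e1, e2⟩ := hinv x
    rw [mem_segment_prod_iff, mem_segment_prod_iff]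
    refine ⟨⟨?_, fun h => ⟨s + (φ x).2, by linarith, by linarith, ?_, ?_⟩⟩,
      ⟨?_, fun h => ⟨t + (φ x).1, by linarith, by linarith, ?_, ?_⟩⟩⟩
    · rintro ⟨r, -, -, g1, g2⟩
      rw [hφ1, g1, g2, h1, h2]
      ring
    · rw [h] at e1
      rw [e1, h1]
      ring
    · rw [h] at e2
      rw [e2, h2]
      ring
    · rintro ⟨r, -, -, g1, g2⟩
      rw [hφ2, g1, g2, h3, h4]
      ring
    · rw [h] at e1
      rw [e1, h3]
      ring
    · rw [h] at e2
      rw [e2, h4]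
      ring

/-- Parallel lines with a common point coincide, and then `p` would lie on the line `ab`. -/
theorem direction_ne_of_signedArea_ne_zero {a b p q : ℝ × ℝ} {s t : ℝ}
    (h1 : a.1 + s * (b.1 - a.1) = p.1 + t * (q.1 - p.1))
    (h2 : a.2 + s * (b.2 - a.2) = p.2 + t * (q.2 - p.2)) (h : signedArea a b p ≠ 0) :
    (b.1 - a.1) * (q.2 - p.2) - (b.2 - a.2) * (q.1 - p.1) ≠ 0 := by
  intro hD
  apply h
  unfold signedArea
  linear_combination (b.2 - a.2) * h1 - (b.1 - a.1) * h2 - t * hD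

theorem signedArea_eq_zero_of_mem_segment {a b x : ℝ × ℝ} (hx : x ∈ segment ℝ a b) :
    signedArea a b x = 0 := by
  obtain ⟨t, -, -, h1, h2⟩ := mem_segment_prod_iff.1 hx
  unfold signedArea
  rw [h1, h2]
  ring

theorem segment_inter_segment_of_signedArea_ne_zero {a b c : ℝ × ℝ} (h : signedArea a b c ≠ 0) :
    segment ℝ a b ∩ segment ℝ a c = {a} := by
  ext x
  constructor
  · rintro ⟨hb, hc⟩
    obtain ⟨s, -, -, h1, h2⟩ := mem_segment_prod_iff.1 hb
    obtain ⟨t, -, -, h3, h4⟩ := mem_segment_prod_iff.1 hc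
    have ht : t * signedArea a b c = 0 := by
      unfold signedArea
      linear_combination (b.1 - a.1) * (h2 - h4) - (b.2 - a.2) * (h1 - h3)
    rcases mul_eq_zero.1 ht with rfl | ht
    · exact Prod.ext (by simpa using h3) (by simpa using h4)
    · exact (h ht).elim
  · rintro rfl
    exact ⟨left_mem_segment ℝ _ _, left_mem_segment ℝ _ _⟩

theorem eq_of_mem_segment_inter {a b p q x y : ℝ × ℝ} (h : signedArea a b p ≠ 0)
    (hx : x ∈ segment ℝ a b) (hx' : x ∈ segment ℝ p q) (hy : y ∈ segment ℝ a b)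
    (hy' : y ∈ segment ℝ p q) : x = y := by
  obtain ⟨s, -, -, h1, h2⟩ := mem_segment_prod_iff.1 hx
  obtain ⟨t, -, -, h3, h4⟩ := mem_segment_prod_iff.1 hx'
  obtain ⟨s', -, -, h1', h2'⟩ := mem_segment_prod_iff.1 hy
  obtain ⟨t', -, -, h3', h4'⟩ := mem_segment_prod_iff.1 hy'
  have hD := direction_ne_of_signedArea_ne_zero (h1.symm.trans h3) (h2.symm.trans h4) h
  have hs : (s - s') * ((b.1 - a.1) * (q.2 - p.2) - (b.2 - a.2) * (q.1 - p.1)) = 0 := by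
    linear_combination (q.2 - p.2) * (h3 - h1 - h3' + h1') - (q.1 - p.1) * (h4 - h2 - h4' + h2')
  have hs' : s = s' := by
    rcases mul_eq_zero.1 hs with h | h
    · linarith
    · exact (hD h).elim
  subst hs'
  exact Prod.ext (h1.trans h1'.symm) (h2.trans h2'.symm)

/-- An affine function that separates the end points separates the segments. -/
theorem disjoint_segment_of_separated {a b p q : ℝ × ℝ} (α β γ : ℝ)
    (ha : α * a.1 + β * a.2 + γ ≤ 0) (hb : α * b.1 + β * b.2 + γ ≤ 0)
    (hp : 0 < α * p.1 + β * p.2 + γ) (hq : 0 < α * q.1 + β * q.2 + γ) :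
    Disjoint (segment ℝ a b) (segment ℝ p q) := by
  rw [Set.disjoint_left]
  intro x hx hx'
  obtain ⟨s, hs0, hs1, h1, h2⟩ := mem_segment_prod_iff.1 hx
  obtain ⟨t, ht0, ht1, h3, h4⟩ := mem_segment_prod_iff.1 hx'
  have e1 : α * x.1 + β * x.2 + γ ≤ 0 := by
    have : α * x.1 + β * x.2 + γ =
        (1 - s) * (α * a.1 + β * a.2 + γ) + s * (α * b.1 + β * b.2 + γ) := by
      rw [h1, h2]; ring
    rw [this]
    have := mul_nonneg (sub_nonneg.2 hs1) (neg_nonneg.2 ha)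
    have := mul_nonneg hs0 (neg_nonneg.2 hb)
    linarith
  have e2 : 0 < α * x.1 + β * x.2 + γ := by
    have : α * x.1 + β * x.2 + γ =
        (1 - t) * (α * p.1 + β * p.2 + γ) + t * (α * q.1 + β * q.2 + γ) := by
      rw [h3, h4]; ring
    rw [this]
    rcases ht0.eq_or_lt with rfl | ht
    · simpa using hp
    · have := mul_nonneg (sub_nonneg.2 ht1) hp.le
      have := mul_pos ht hq
      linarith
  exact e2.not_ge e1

/-- The straight-line drawing of a graph on points in general position. -/
def straightLineDrawing {V : Type*} (G : SimpleGraph V) (pos : V → ℝ × ℝ)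
    (hpos : Function.Injective pos)
    (hgen : ∀ u v w, u ≠ v → u ≠ w → v ≠ w → signedArea (pos u) (pos v) (pos w) ≠ 0) :
    PlaneDrawing G where
  pos := pos
  arc := Sym2.lift ⟨fun u v => segment ℝ (pos u) (pos v), fun _ _ => segment_symm ℝ _ _⟩
  pos_injective := hpos
  isSimpleArc := fun u v h => isSimpleArc_segment (hpos.ne h.ne)
  mem_of_pos_mem := by
    intro e he w hw
    induction e with | _ u v
    by_contra hn
    rw [Sym2.mem_iff, not_or] at hn
    exact hgen u v w (G.ne_of_adj he) (Ne.symm hn.1) (Ne.symm hn.2)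
      (signedArea_eq_zero_of_mem_segment hw)
  adjacent_meet := fun u v w huv huw hvw =>
    segment_inter_segment_of_signedArea_ne_zero (hgen u v w huv.ne huw.ne hvw)
  proper := by
    intro e he f hf hef c hc hcv
    induction e with | _ u v
    induction f with | _ x y
    obtain ⟨hc1, hc2⟩ := hc
    have huv : u ≠ v := G.ne_of_adj he
    have hxy : x ≠ y := G.ne_of_adj hf
    change c ∈ segment ℝ (pos u) (pos v) at hc1
    change c ∈ segment ℝ (pos x) (pos y) at hc2
    change CrossProperlyAt (segment ℝ (pos u) (pos v)) (segment ℝ (pos x) (pos y)) c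
    have hadj : ∀ a b b', a ≠ b → a ≠ b' → b ≠ b' → c ∈ segment ℝ (pos a) (pos b) →
        c ∈ segment ℝ (pos a) (pos b') → False := by
      intro a b b' hab hab' hbb h h'
      have := (segment_inter_segment_of_signedArea_ne_zero (hgen a b b' hab hab' hbb)).subset ⟨h, h'⟩
      exact hcv ⟨a, this.symm⟩
    have hux : x ≠ u := by
      rintro rfl
      exact hadj x v y huv hxy (fun h => hef (by rw [h])) hc1 hc2
    have hvx : x ≠ v := by
      rintro rfl
      exact hadj x u y huv.symm hxy (fun h => hef (by rw [h, Sym2.eq_swap]))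
        (segment_symm ℝ (pos u) (pos x) ▸ hc1) hc2
    have hne : ∀ a, c ≠ pos a := fun a h => hcv ⟨a, h.symm⟩
    obtain ⟨s, hs0, hs1, h1, h2⟩ := mem_segment_prod_iff.1 hc1
    obtain ⟨t, ht0, ht1, h3, h4⟩ := mem_segment_prod_iff.1 hc2
    refine crossProperlyAt_segment (hs0.lt_of_ne' ?_) (hs1.lt_of_ne ?_) (ht0.lt_of_ne' ?_)
      (ht1.lt_of_ne ?_) h1 h2 h3 h4 (direction_ne_of_signedArea_ne_zero (h1.symm.trans h3)
        (h2.symm.trans h4) (hgen u v x huv hux.symm hvx.symm))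
    · rintro rfl
      exact hne u (Prod.ext (by simpa using h1) (by simpa using h2))
    · rintro rfl
      exact hne v (Prod.ext (by simpa using h1) (by simpa using h2))
    · rintro rfl
      exact hne x (Prod.ext (by simpa using h3) (by simpa using h4))
    · rintro rfl
      exact hne y (Prod.ext (by simpa using h3) (by simpa using h4))

theorem straightLineDrawing_crosses_unique {V : Type*} {G : SimpleGraph V} {pos : V → ℝ × ℝ}
    {hpos : Function.Injective pos}
    {hgen : ∀ u v w, u ≠ v → u ≠ w → v ≠ w → signedArea (pos u) (pos v) (pos w) ≠ 0}
    {e f : Sym2 V} {c c' : ℝ × ℝ} (h : (straightLineDrawing G pos hpos hgen).Crosses e f c)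
    (h' : (straightLineDrawing G pos hpos hgen).Crosses e f c') : c = c' := by
  have hn : ∀ w, w ∈ e → w ∉ f := fun w hw => h.notMem hw
  induction e with | _ u v
  induction f with | _ x y
  simp only [Sym2.mem_iff, not_or] at hn
  have hu := hn u (.inl rfl)
  have hv := hn v (.inr rfl)
  exact eq_of_mem_segment_inter (hgen u v x (G.ne_of_adj h.1) hu.1 hv.1) h.2.2.2.1 h.2.2.2.2.1
    h'.2.2.2.1 h'.2.2.2.2.1

/-- A drawing is a `𝒞₀`-drawing if the vertices can be labelled in such a way that the four ends
of any two crossing edges have the same label, and this label determines the two edges and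
their crossing. -/
theorem PlaneDrawing.isC0Drawing_of_label {V ι κ : Type*} {G : SimpleGraph V} (D : PlaneDrawing G)
    (hD : ∀ e f c c', D.Crosses e f c → D.Crosses e f c' → c = c') (label : V → ι)
    {g : Sym2 V → κ} (hg : Function.Injective g) (E F : ι → κ)
    (h : ∀ e f c, D.Crosses e f c → ∃ i, (g e = E i ∧ g f = F i ∨ g e = F i ∧ g f = E i) ∧
      ∀ w, w ∈ e ∨ w ∈ f → label w = i) : D.IsC0Drawing := by
  -- Two crossings with a common end vertex `w` are the same. This gives 1-planarity as well as the
  -- absence of common neighbours.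
  have key : ∀ e f c e' f' c' w, D.Crosses e f c → D.Crosses e' f' c' → (w ∈ e ∨ w ∈ f) →
      (w ∈ e' ∨ w ∈ f') → c = c' ∧ (e = e' ∧ f = f' ∨ e = f' ∧ f = e') := by
    intro e f c e' f' c' w hc hc' hw hw'
    obtain ⟨i, hi, hl⟩ := h e f c hc
    obtain ⟨j, hj, hl'⟩ := h e' f' c' hc'
    obtain rfl : i = j := (hl w hw).symm.trans (hl' w hw')
    have : e = e' ∧ f = f' ∨ e = f' ∧ f = e' := by
      rw [← hg.eq_iff, ← hg.eq_iff (a := f), ← hg.eq_iff (b := f'), ← hg.eq_iff (a := f) (b := e')]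
      grind
    refine ⟨?_, this⟩
    rcases this with ⟨rfl, rfl⟩ | ⟨rfl, rfl⟩
    · exact hD _ _ _ _ hc hc'
    · exact hD _ _ _ _ hc hc'.symm
  refine ⟨fun e f f' c c' hc hc' => ?_, fun c₁ c₂ hne => ?_⟩
  · obtain ⟨w, hw⟩ : ∃ w, w ∈ e := by
      induction e with | _ x y
      exact ⟨x, Sym2.mem_mk_left x y⟩
    obtain ⟨h1, ⟨-, h2⟩ | ⟨h2, h3⟩⟩ := key e f c e f' c' w hc hc' (.inl hw) (.inl hw)
    · exact ⟨h2, h1⟩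
    · exact ⟨h3.trans h2, h1⟩
  · rw [Set.encard_eq_zero, Set.eq_empty_iff_forall_notMem]
    rintro (w | c) ⟨hw₁, hw₂⟩
    · have hcr : ∀ c : D.FalseVertex, D.AssociatedAdj (.inr c) (.inl w) →
          ∃ e f, D.Crosses e f c.1 ∧ w ∈ e := by
        rintro ⟨c, e, f, hc⟩ ⟨g, hg, hwg, hcg⟩
        by_cases hge : g = e
        · exact ⟨e, f, hc, hge ▸ hwg⟩
        · exact ⟨g, e, ⟨hg, hc.1, hge, hcg, hc.2.2.2.1, hc.2.2.2.2.2⟩, hwg⟩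
      obtain ⟨e, f, hc, he⟩ := hcr c₁ hw₁
      obtain ⟨e', f', hc', he'⟩ := hcr c₂ hw₂
      exact hne (Subtype.ext (key e f _ e' f' _ w hc hc' (.inl he) (.inl he')).1)
    · exact hw₁

/-! ### The drawing of the extremal graph

The vertices are labelled by integers: the label `0` stands for an inner point, the label `k` for
the top point, and every other label `t` for the point `(t, -t²)` of a parabola. -/

/-- The point with label `t`. -/
noncomputable def labelPoint (k t : ℤ) : ℝ × ℝ :=
  if t = 0 then (0, -3 / 2) else if t = k then (0, (k : ℝ) ^ 2) else ((t : ℝ), -(t : ℝ) ^ 2)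

/-! ### General position of the labelled points -/

theorem labelPoint_zero (k : ℤ) : labelPoint k 0 = (0, -3 / 2) := if_pos rfl

theorem labelPoint_self {k : ℤ} (hk : 0 < k) : labelPoint k k = (0, (k : ℝ) ^ 2) := by
  rw [labelPoint, if_neg hk.ne', if_pos rfl]

theorem labelPoint_of_ne {k t : ℤ} (h0 : t ≠ 0) (hk : t ≠ k) :
    labelPoint k t = ((t : ℝ), -(t : ℝ) ^ 2) := by
  rw [labelPoint, if_neg h0, if_neg hk]

theorem mul_lt_sq_of_abs_lt {k s t : ℤ} (hs : |s| < k) (ht : |t| < k) :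
    (s : ℝ) * t < (k : ℝ) ^ 2 := by
  have h : s * t < k ^ 2 := by
    calc s * t ≤ |s * t| := le_abs_self _
      _ = |s| * |t| := abs_mul s t
      _ < k * k := mul_lt_mul'' hs ht (abs_nonneg s) (abs_nonneg t)
      _ = k ^ 2 := by ring
  exact_mod_cast h

theorem mul_ne_neg_three_halves (s t : ℤ) : (s : ℝ) * t + 3 / 2 ≠ 0 := by
  intro h
  have : 2 * (s * t) = -3 := by
    have h' : 2 * ((s : ℝ) * t) = -3 := by linarith
    exact_mod_cast h'
  omega

/-- The line through the parabola points `s` and `t` meets the vertical axis at height `s * t`. This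
is an integer, so never `-3/2`, and it is less than `k ^ 2`; hence the inner and the top point are
on no such line. -/
theorem signedArea_labelPoint_ne_zero_of_lt {k u v w : ℤ} (hu : -k < u) (huv : u < v)
    (hvw : v < w) (hw : w ≤ k) :
    signedArea (labelPoint k u) (labelPoint k v) (labelPoint k w) ≠ 0 := by
  have huv' : (v : ℝ) - u ≠ 0 := sub_ne_zero.2 (by exact_mod_cast huv.ne')
  have hvw' : (w : ℝ) - v ≠ 0 := sub_ne_zero.2 (by exact_mod_cast hvw.ne')
  have huw' : (w : ℝ) - u ≠ 0 := sub_ne_zero.2 (by exact_mod_cast (huv.trans hvw).ne')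
  have hk : 0 < k := by omega
  have hk' : (k : ℝ) ^ 2 + 3 / 2 ≠ 0 := by positivity
  have hc := mul_ne_neg_three_halves
  have hz : ∀ s t : ℤ, |s| < k → |t| < k → (k : ℝ) ^ 2 - s * t ≠ 0 := fun s t hs ht =>
    (sub_pos.2 (mul_lt_sq_of_abs_lt hs ht)).ne'
  have hne : ∀ {x y : ℝ}, y ≠ 0 → x = y → x ≠ 0 := fun h h' => h' ▸ h
  rcases hw.lt_or_eq with hwk | rfl
  · by_cases hu0 : u = 0
    · subst hu0
      rw [labelPoint_zero, labelPoint_of_ne huv.ne' (by omega), labelPoint_of_ne (by omega) hwk.ne]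
      refine hne (neg_ne_zero.2 (mul_ne_zero hvw' (hc v w))) ?_
      simp only [signedArea]
      ring
    by_cases hv0 : v = 0
    · subst hv0
      rw [labelPoint_zero, labelPoint_of_ne hu0 (by omega), labelPoint_of_ne (by omega) hwk.ne]
      refine hne (mul_ne_zero huw' (hc u w)) ?_
      simp only [signedArea]
      ring
    by_cases hw0 : w = 0
    · subst hw0
      rw [labelPoint_zero, labelPoint_of_ne hu0 (by omega), labelPoint_of_ne (by omega) (by omega)]
      refine hne (neg_ne_zero.2 (mul_ne_zero huv' (hc u v))) ?_
      simp only [signedArea]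
      ring
    rw [labelPoint_of_ne hu0 (by omega), labelPoint_of_ne hv0 (by omega),
      labelPoint_of_ne hw0 hwk.ne]
    refine hne (neg_ne_zero.2 (mul_ne_zero (mul_ne_zero huv' huw') hvw')) ?_
    simp only [signedArea]
    ring
  · rw [labelPoint_self hk]
    by_cases hu0 : u = 0
    · subst hu0
      rw [labelPoint_zero, labelPoint_of_ne huv.ne' (by omega)]
      refine hne (mul_ne_zero huv' hk') ?_
      simp only [signedArea, Int.cast_zero]
      ring
    by_cases hv0 : v = 0
    · subst hv0
      rw [labelPoint_zero, labelPoint_of_ne hu0 (by omega)]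
      refine hne (mul_ne_zero huv' hk') ?_
      simp only [signedArea, Int.cast_zero]
      ring
    rw [labelPoint_of_ne hu0 (by omega), labelPoint_of_ne hv0 (by omega)]
    refine hne (mul_ne_zero huv' (hz u v (by rw [abs_lt]; omega) (by rw [abs_lt]; omega))) ?_
    simp only [signedArea]
    ring

theorem signedArea_swap_left (a b c : ℝ × ℝ) : signedArea b a c = -signedArea a b c := by
  simp only [signedArea]; ring

theorem signedArea_swap_right (a b c : ℝ × ℝ) : signedArea a c b = -signedArea a b c := by
  simp only [signedArea]; ring

theorem signedArea_labelPoint_ne_zero {k u v w : ℤ} (hu : -k < u) (hv : -k < v) (hw : -k < w)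
    (hu' : u ≤ k) (hv' : v ≤ k) (hw' : w ≤ k) (huv : u ≠ v) (huw : u ≠ w) (hvw : v ≠ w) :
    signedArea (labelPoint k u) (labelPoint k v) (labelPoint k w) ≠ 0 := by
  have key := @signedArea_labelPoint_ne_zero_of_lt k
  rcases lt_or_gt_of_ne huv with h1 | h1 <;> rcases lt_or_gt_of_ne huw with h2 | h2 <;>
    rcases lt_or_gt_of_ne hvw with h3 | h3
  · exact key hu h1 h3 hw'
  · rw [signedArea_swap_right]
    exact neg_ne_zero.2 (key hu h2 h3 hv')
  · omega
  · rw [signedArea_swap_right, signedArea_swap_left]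
    exact neg_ne_zero.2 (neg_ne_zero.2 (key hw h2 h1 hv'))
  · rw [signedArea_swap_left]
    exact neg_ne_zero.2 (key hv h1 h2 hw')
  · omega
  · rw [signedArea_swap_left, signedArea_swap_right]
    exact neg_ne_zero.2 (neg_ne_zero.2 (key hv h3 h2 hu'))
  · rw [signedArea_swap_left, signedArea_swap_right, signedArea_swap_left]
    exact neg_ne_zero.2 (neg_ne_zero.2 (neg_ne_zero.2 (key hw h3 h1 hu')))

/-! ### Edges in terms of labels, and which of them meet -/

/-- The edges of the drawing between labels of parabola points. -/
def IsChord (k a b : ℤ) : Prop :=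
  -k < a ∧ b < k ∧ a ≠ 0 ∧ b ≠ 0 ∧ a < b ∧
    (b = a + 1 ∨ b = -a ∨ b = 1 - a ∧ a ≤ -2 ∨ b = -a - 1 ∧ 2 ≤ b ∧ b % 2 = 0)

/-- The edges of the drawing, from the smaller to the larger label. -/
def IsLabelEdge (k a b : ℤ) : Prop :=
  IsChord k a b ∨ a = 0 ∧ (b = 1 ∨ b = 2) ∨ b = 0 ∧ (a = -1 ∨ a = -2) ∨ b = k ∧ -k < a ∧ a < k

/-- The pairs of crossing edges. -/
def IsCrossingPair (k a b a' b' : ℤ) : Prop :=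
  (∃ s, 2 ≤ s ∧ s % 2 = 0 ∧ a = -s ∧ b = s + 1 ∧ a' = -s - 1 ∧ b' = s) ∨
    a = 0 ∧ b = k ∧ a' = -1 ∧ b' = 1

/-- The line of the chord `ab` separates: `(a + b) x + y - a b` vanishes on it and equals `-(t -
a)(t - b)` at the parabola point `t`. -/
theorem disjoint_chords {k a b p q : ℤ} (h : IsChord k a b)
    (hp' : p < k) (hq' : q < k) (hp0 : p ≠ 0) (hq0 : q ≠ 0)
    (hs : (a < p ∧ p < b ∧ a < q ∧ q < b) ∨ ((p < a ∨ b < p) ∧ (q < a ∨ b < q))) :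
    Disjoint (segment ℝ (labelPoint k a) (labelPoint k b))
      (segment ℝ (labelPoint k p) (labelPoint k q)) := by
  obtain ⟨ha, hb, ha0, hb0, hab, -⟩ := h
  rw [labelPoint_of_ne ha0 (by omega), labelPoint_of_ne hb0 hb.ne, labelPoint_of_ne hp0 hp'.ne,
    labelPoint_of_ne hq0 hq'.ne]
  have hin : ∀ x : ℤ, a < x → x < b → 0 < -(((x : ℝ) - a) * (x - b)) := by
    intro x h1 h2
    have h1' : (0 : ℝ) < x - a := sub_pos.2 (by exact_mod_cast h1)
    have h2' : (x : ℝ) - b < 0 := sub_neg.2 (by exact_mod_cast h2)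
    exact neg_pos.2 (mul_neg_of_pos_of_neg h1' h2')
  have hout : ∀ x : ℤ, x < a ∨ b < x → 0 < ((x : ℝ) - a) * (x - b) := by
    rintro x (h | h)
    · have h1 : (x : ℝ) - a < 0 := sub_neg.2 (by exact_mod_cast h)
      have h2 : (x : ℝ) - b < 0 := sub_neg.2 (by exact_mod_cast h.trans hab)
      exact mul_pos_of_neg_of_neg h1 h2
    · have h1 : (0 : ℝ) < x - a := sub_pos.2 (by exact_mod_cast hab.trans h)
      have h2 : (0 : ℝ) < x - b := sub_pos.2 (by exact_mod_cast h)
      exact mul_pos h1 h2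
  rcases hs with ⟨h1, h2, h3, h4⟩ | ⟨h1, h2⟩
  · have e1 := hin p h1 h2
    have e2 := hin q h3 h4
    refine disjoint_segment_of_separated ((a : ℝ) + b) 1 (-(a * b)) ?_ ?_ ?_ ?_ <;> simp only
    · linarith
    · linarith
    · linarith
    · linarith
  · have e1 := hout p h1
    have e2 := hout q h2
    refine disjoint_segment_of_separated (-((a : ℝ) + b)) (-1) (a * b) ?_ ?_ ?_ ?_ <;> simp only
    · linarith
    · linarith
    · linarith
    · linarith

/-- The chord's line separates again. The inner point, at height `-3/2`, is above that line if `a *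
b ≤ -2` and below it if `a * b ≥ -1`, and in each case `t` is on the same side. -/
theorem disjoint_chord_inner {k a b t : ℤ} (h : IsChord k a b) (hk : 4 ≤ k)
    (ht : t = 1 ∨ t = 2 ∨ t = -1 ∨ t = -2) (hta : t ≠ a) (htb : t ≠ b) :
    Disjoint (segment ℝ (labelPoint k a) (labelPoint k b))
      (segment ℝ (labelPoint k 0) (labelPoint k t)) := by
  obtain ⟨ha, hb, ha0, hb0, hab, hR⟩ := h
  rw [labelPoint_of_ne ha0 (by omega), labelPoint_of_ne hb0 hb.ne, labelPoint_zero,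
    labelPoint_of_ne (by omega) (by omega)]
  have hs : (a * b ≤ -2 ∧ a < t ∧ t < b) ∨ (-1 ≤ a * b ∧ (t < a ∨ b < t)) := by
    rcases hR with rfl | rfl | ⟨rfl, h⟩ | ⟨rfl, h, -⟩
    · exact .inr ⟨by nlinarith [sq_nonneg (2 * a + 1)], by omega⟩
    · by_cases h1 : a = -1
      · subst h1
        exact .inr ⟨by norm_num, by omega⟩
      · have : a ≤ -2 := by omega
        exact .inl ⟨by nlinarith, by omega⟩
    · exact .inl ⟨by nlinarith, by omega⟩
    · exact .inl ⟨by nlinarith, by omega⟩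
  rcases hs with ⟨h1, h2, h3⟩ | ⟨h1, h2⟩
  · have h1' : (a : ℝ) * b ≤ -2 := by exact_mod_cast h1
    have h2' : (0 : ℝ) < t - a := sub_pos.2 (by exact_mod_cast h2)
    have h3' : (0 : ℝ) < b - t := sub_pos.2 (by exact_mod_cast h3)
    have := mul_pos h2' h3'
    refine disjoint_segment_of_separated ((a : ℝ) + b) 1 (-(a * b)) ?_ ?_ ?_ ?_ <;> simp only
    · linarith
    · linarith
    · linarith
    · linarith
  · have h1' : (-1 : ℝ) ≤ a * b := by exact_mod_cast h1
    have h2' : 0 < ((t : ℝ) - a) * (t - b) := by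
      have : 0 < (t - a) * (t - b) := by
        rcases h2 with h | h
        · exact mul_pos_of_neg_of_neg (by omega) (by omega)
        · exact mul_pos (by omega) (by omega)
      exact_mod_cast this
    refine disjoint_segment_of_separated (-((a : ℝ) + b)) (-1) (a * b) ?_ ?_ ?_ ?_ <;> simp only
    · linarith
    · linarith
    · linarith
    · linarith

theorem disjoint_chord_top {k a b t : ℤ} (h : IsChord k a b) (ht : -k < t) (ht' : t < k)
    (ht0 : t ≠ 0) (hta : t ≠ a) (htb : t ≠ b) :
    Disjoint (segment ℝ (labelPoint k a) (labelPoint k b))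
      (segment ℝ (labelPoint k t) (labelPoint k k)) := by
  obtain ⟨ha, hb, ha0, hb0, hab, -⟩ := h
  rw [labelPoint_of_ne ha0 (by omega), labelPoint_of_ne hb0 hb.ne, labelPoint_self (by omega),
    labelPoint_of_ne ht0 ht'.ne]
  have habs : ∀ x, -k < x → x < k → |x| < k := fun x h1 h2 => abs_lt.2 ⟨h1, h2⟩
  have hsgn : ∀ x : ℤ, -k < x → x < k → 0 < (k : ℝ) ^ 2 - t * x := fun x h1 h2 =>
    sub_pos.2 (mul_lt_sq_of_abs_lt (habs t ht ht') (habs x h1 h2))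
  have hka := hsgn a ha (hab.trans hb)
  have hkb := hsgn b (ha.trans hab) hb
  -- If `t` is between `a` and `b`, the chord's line separates. Otherwise the line from `t` to the
  -- top does: its equation takes the value `(x - t)(k² - t x)` at the parabola point `x`.
  rcases lt_or_gt_of_ne hta with h1 | h1
  · have e1 : (0 : ℝ) < a - t := sub_pos.2 (by exact_mod_cast h1)
    have e2 : (0 : ℝ) < b - t := sub_pos.2 (by exact_mod_cast h1.trans hab)
    have := mul_pos e1 hka
    have := mul_pos e2 hkb
    refine (disjoint_segment_of_separated ((k : ℝ) ^ 2 + t ^ 2) t (-(t * k ^ 2)) ?_ ?_ ?_ ?_).symm <;>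
      simp only
    · linarith
    · linarith
    · linarith
    · linarith
  rcases lt_or_gt_of_ne htb with h2 | h2
  · have e1 : (0 : ℝ) < t - a := sub_pos.2 (by exact_mod_cast h1)
    have e2 : (0 : ℝ) < b - t := sub_pos.2 (by exact_mod_cast h2)
    have := mul_pos e1 e2
    have := mul_lt_sq_of_abs_lt (habs a ha (hab.trans hb)) (habs b (ha.trans hab) hb)
    refine disjoint_segment_of_separated ((a : ℝ) + b) 1 (-(a * b)) ?_ ?_ ?_ ?_ <;> simp only
    · linarith
    · linarith
    · linarith
    · linarith
  · have e1 : (0 : ℝ) < t - a := sub_pos.2 (by exact_mod_cast h1)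
    have e2 : (0 : ℝ) < t - b := sub_pos.2 (by exact_mod_cast h2)
    have := mul_pos e1 hka
    have := mul_pos e2 hkb
    refine (disjoint_segment_of_separated (-((k : ℝ) ^ 2 + t ^ 2)) (-t) (t * k ^ 2)
      ?_ ?_ ?_ ?_).symm <;> simp only
    · linarith
    · linarith
    · linarith
    · linarith

theorem disjoint_chord_axis {k a b : ℤ} (h : IsChord k a b) (hab : ¬ (a = -1 ∧ b = 1)) :
    Disjoint (segment ℝ (labelPoint k a) (labelPoint k b))
      (segment ℝ (labelPoint k 0) (labelPoint k k)) := by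
  obtain ⟨ha, hb, ha0, hb0, hlt, hR⟩ := h
  rw [labelPoint_of_ne ha0 (by omega), labelPoint_of_ne hb0 hb.ne, labelPoint_self (by omega),
    labelPoint_zero]
  by_cases hcons : b = a + 1
  · rcases lt_or_gt_of_ne ha0 with h | h
    · have h1 : (a : ℝ) < 0 := by exact_mod_cast h
      have h2 : (b : ℝ) < 0 := by exact_mod_cast (show b < 0 by omega)
      refine (disjoint_segment_of_separated (-1) 0 0 ?_ ?_ ?_ ?_).symm <;> simp only
      · linarith
      · linarith
      · linarith
      · linarith
    · have h1 : (0 : ℝ) < a := by exact_mod_cast h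
      have h2 : (0 : ℝ) < b := by exact_mod_cast (show 0 < b by omega)
      refine (disjoint_segment_of_separated 1 0 0 ?_ ?_ ?_ ?_).symm <;> simp only
      · linarith
      · linarith
      · linarith
      · linarith
  · have h1 : a * b ≤ -2 := by
      rcases hR with rfl | rfl | ⟨rfl, h⟩ | ⟨rfl, h, -⟩
      · exact absurd rfl hcons
      · have : a ≤ -2 := by omega
        nlinarith
      · nlinarith
      · nlinarith
    have h1' : (a : ℝ) * b ≤ -2 := by exact_mod_cast h1
    have h2 : (0 : ℝ) ≤ (k : ℝ) ^ 2 := sq_nonneg _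
    refine disjoint_segment_of_separated ((a : ℝ) + b) 1 (-(a * b)) ?_ ?_ ?_ ?_ <;> simp only
    · linarith
    · linarith
    · linarith
    · linarith

theorem disjoint_inner_top {k s t : ℤ} (hk : 4 ≤ k) (ht : t = 1 ∨ t = 2 ∨ t = -1 ∨ t = -2)
    (hs : -k < s) (hs' : s < k) (hs0 : s ≠ 0) (hst : t ≠ s) :
    Disjoint (segment ℝ (labelPoint k 0) (labelPoint k t))
      (segment ℝ (labelPoint k s) (labelPoint k k)) := by
  rw [labelPoint_of_ne (t := t) (by omega) (by omega), labelPoint_zero,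
    labelPoint_self (by omega), labelPoint_of_ne hs0 hs'.ne]
  have hk2 : (0 : ℝ) < (k : ℝ) ^ 2 := by
    have : (0 : ℝ) < k := by exact_mod_cast (show 0 < k by omega)
    positivity
  have hkt := mul_lt_sq_of_abs_lt (abs_lt.2 ⟨hs, hs'⟩)
    (abs_lt.2 (⟨by omega, by omega⟩ : -k < t ∧ t < k))
  by_cases h1 : 0 < s ∧ t < s
  · have e1 : (0 : ℝ) < s := by exact_mod_cast h1.1
    have e2 : (0 : ℝ) < s - t := sub_pos.2 (by exact_mod_cast h1.2)
    have := mul_pos e1 hk2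
    have := mul_pos e2 (sub_pos.2 hkt)
    refine (disjoint_segment_of_separated (-((k : ℝ) ^ 2 + s ^ 2)) (-s) (s * k ^ 2)
      ?_ ?_ ?_ ?_).symm <;> simp only
    · linarith
    · linarith
    · linarith
    · linarith
  by_cases h2 : s < 0 ∧ s < t
  · have e1 : (0 : ℝ) < -s := neg_pos.2 (by exact_mod_cast h2.1)
    have e2 : (0 : ℝ) < t - s := sub_pos.2 (by exact_mod_cast h2.2)
    have := mul_pos e1 hk2
    have := mul_pos e2 (sub_pos.2 hkt)
    refine (disjoint_segment_of_separated ((k : ℝ) ^ 2 + s ^ 2) s (-(s * k ^ 2))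
      ?_ ?_ ?_ ?_).symm <;> simp only
    · linarith
    · linarith
    · linarith
    · linarith
  -- What remains is `s = ±1`, `t = 2s`. The height `-5/4` is between the inner point at `-3/2` and
  -- the point `s` at `-1`.
  · have hs1 : (s : ℝ) ^ 2 = 1 := by
      rcases (show s = 1 ∨ s = -1 by omega) with rfl | rfl <;> norm_num
    have ht1 : (t : ℝ) ^ 2 = 4 := by
      rcases (show t = 2 ∨ t = -2 by omega) with rfl | rfl <;> norm_num
    refine disjoint_segment_of_separated 0 1 (5 / 4) ?_ ?_ ?_ ?_ <;> simp only
    · linarith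
    · linarith
    · linarith
    · linarith

theorem IsLabelEdge.cases {k a b : ℤ} (h : IsLabelEdge k a b) :
    IsChord k a b ∨
    (∃ t, (t = 1 ∨ t = 2 ∨ t = -1 ∨ t = -2) ∧ (a = 0 ∧ b = t ∨ a = t ∧ b = 0) ∧
      segment ℝ (labelPoint k a) (labelPoint k b) =
        segment ℝ (labelPoint k 0) (labelPoint k t)) ∨
    (b = k ∧ -k < a ∧ a < k ∧ a ≠ 0) ∨ (a = 0 ∧ b = k) := by
  rcases h with h | ⟨rfl, h⟩ | ⟨rfl, h⟩ | ⟨rfl, h⟩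
  · exact .inl h
  · exact .inr (.inl ⟨b, by tauto, .inl ⟨rfl, rfl⟩, rfl⟩)
  · exact .inr (.inl ⟨a, by tauto, .inr ⟨rfl, rfl⟩, segment_symm ℝ _ _⟩)
  · by_cases h0 : a = 0
    · exact .inr (.inr (.inr ⟨h0, rfl⟩))
    · exact .inr (.inr (.inl ⟨rfl, h.1, h.2, h0⟩))

theorem isCrossingPair_of_mem_segment {k a b a' b' : ℤ} (hk : 4 ≤ k) (h : IsLabelEdge k a b)
    (h' : IsLabelEdge k a' b') (h1 : a ≠ a') (h2 : a ≠ b') (h3 : b ≠ a') (h4 : b ≠ b')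
    {x : ℝ × ℝ} (hx : x ∈ segment ℝ (labelPoint k a) (labelPoint k b))
    (hx' : x ∈ segment ℝ (labelPoint k a') (labelPoint k b')) :
    IsCrossingPair k a b a' b' ∨ IsCrossingPair k a' b' a b := by
  have hn : ∀ {A B : Set (ℝ × ℝ)}, Disjoint A B → x ∈ A → x ∈ B → False := fun h =>
    fun hA hB => Set.disjoint_left.1 h hA hB
  rcases h.cases with hc | ⟨t, ht, hab, hseg⟩ | ⟨hbk, ha, hak, ha0⟩ | ⟨ha0, hbk⟩ <;>
    rcases h'.cases with hc' | ⟨t', ht', hab', hseg'⟩ | ⟨hbk', ha', hak', ha0'⟩ | ⟨ha0', hbk'⟩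
  · by_cases hs : (a < a' ∧ a' < b ∧ a < b' ∧ b' < b) ∨ ((a' < a ∨ b < a') ∧ (b' < a ∨ b < b'))
    · obtain ⟨p1, p2, p3, p4, p5, -⟩ := hc'
      exact (hn (disjoint_chords hc (by omega) p2 p3 p4 hs) hx hx').elim
    · obtain ⟨-, -, q3, q4, q5, q6⟩ := hc
      obtain ⟨-, -, p3, p4, p5, p6⟩ := hc'
      -- The two chords interlace. The admissible forms of a chord then leave only the pairs with
      -- `s` the smaller of the two right ends.
      by_cases hlt : a < a'
      · exact .inr (.inl ⟨b, by omega, by omega, by omega, by omega, by omega, by omega⟩)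
      · exact .inl (.inl ⟨b', by omega, by omega, by omega, by omega, by omega, by omega⟩)
  · rw [hseg'] at hx'
    exact (hn (disjoint_chord_inner hc hk ht' (by omega) (by omega)) hx hx').elim
  · subst hbk'
    exact (hn (disjoint_chord_top hc ha' hak' ha0' h1.symm h3.symm) hx hx').elim
  · subst ha0' hbk'
    by_cases hab : a = -1 ∧ b = 1
    · exact .inr (.inr ⟨rfl, rfl, hab.1, hab.2⟩)
    · exact (hn (disjoint_chord_axis hc hab) hx hx').elim
  · rw [hseg] at hx
    exact (hn (disjoint_chord_inner hc' hk ht (by omega) (by omega)) hx' hx).elim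
  · omega
  · rw [hseg] at hx
    subst hbk'
    exact (hn (disjoint_inner_top hk ht ha' hak' ha0' (by omega)) hx hx').elim
  · omega
  · subst hbk
    exact (hn (disjoint_chord_top hc' ha hak ha0 h1 h2) hx' hx).elim
  · rw [hseg'] at hx'
    subst hbk
    exact (hn (disjoint_inner_top hk ht' ha hak ha0 (by omega)) hx' hx).elim
  · omega
  · omega
  · subst ha0 hbk
    by_cases hab : a' = -1 ∧ b' = 1
    · exact .inl (.inr ⟨rfl, rfl, hab.1, hab.2⟩)
    · exact (hn (disjoint_chord_axis hc' hab) hx' hx).elim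
  · omega
  · omega
  · omega

/-! ### Placing the extremal graph on the labels -/

/-- The label of a vertex of the extremal graph with a top vertex added. -/
def interlacedLabel (k : ℕ) : (Fin k ⊕ Fin (k - 1)) ⊕ Fin 1 → ℤ
  | .inl (.inl i) => if i.val + 2 = k then 0 else if i.val + 1 = k then -1 else i.val + 1 - k
  | .inl (.inr i) => k - (i.val + 1)
  | .inr _ => k

theorem interlacedLabel_injective (k : ℕ) : Function.Injective (interlacedLabel k) := by
  rintro ((⟨i, hi⟩ | ⟨i, hi⟩) | i) ((⟨j, hj⟩ | ⟨j, hj⟩) | j) h <;>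
    simp only [interlacedLabel] at h
  · obtain rfl : i = j := by split_ifs at h <;> omega
    rfl
  · exfalso
    split_ifs at h <;> omega
  · exfalso
    split_ifs at h <;> omega
  · exfalso
    split_ifs at h <;> omega
  · obtain rfl : i = j := by omega
    rfl
  · omega
  · exfalso
    split_ifs at h <;> omega
  · omega
  · rw [Subsingleton.elim i j]

theorem interlacedLabel_bounds {k : ℕ} (hk : 4 ≤ k) (v : (Fin k ⊕ Fin (k - 1)) ⊕ Fin 1) :
    -(k : ℤ) < interlacedLabel k v ∧ interlacedLabel k v ≤ k := by
  rcases v with (⟨i, hi⟩ | ⟨i, hi⟩) | i <;> simp only [interlacedLabel]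
  · split_ifs <;> omega
  · omega
  · omega

theorem isLabelEdge_of_interlacedRel {k : ℕ} (hk : 4 ≤ k) (hke : Even k)
    {u v : Fin k ⊕ Fin (k - 1)} (h : interlacedRel k u v) :
    IsLabelEdge k (interlacedLabel k (.inl u)) (interlacedLabel k (.inl v)) ∨
      IsLabelEdge k (interlacedLabel k (.inl v)) (interlacedLabel k (.inl u)) := by
  rcases u with ⟨i, hi⟩ | ⟨i, hi⟩ <;> rcases v with ⟨j, hj⟩ | ⟨j, hj⟩ <;>
    simp only [interlacedRel, interlacedLabel, Nat.even_iff] at h hke ⊢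
  · rcases h with rfl | ⟨h1, h2⟩
    · by_cases hi2 : i + 2 = k
      · rw [if_pos hi2, if_neg (by omega), if_pos (by omega)]
        exact .inr (.inr (.inr (.inl ⟨rfl, .inl rfl⟩)))
      · rw [if_neg hi2, if_neg (by omega)]
        by_cases hi3 : i + 3 = k
        · rw [if_pos (by omega)]
          exact .inl (.inr (.inr (.inl ⟨rfl, .inr (by omega)⟩)))
        · rw [if_neg (by omega), if_neg (by omega)]
          exact .inl (.inl ⟨by omega, by omega, by omega, by omega, by omega, .inl (by omega)⟩)
    · rw [if_neg (by omega), if_neg (by omega), if_neg (by omega), if_pos h2]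
      exact .inl (.inl ⟨by omega, by omega, by omega, by omega, by omega, .inl (by omega)⟩)
  · rcases h with rfl | rfl | ⟨h1, h2, rfl⟩
    · by_cases hi2 : i + 2 = k
      · rw [if_pos hi2]
        exact .inl (.inr (.inl ⟨rfl, .inl (by omega)⟩))
      · rw [if_neg hi2, if_neg (by omega)]
        exact .inl (.inl ⟨by omega, by omega, by omega, by omega, by omega,
          .inr (.inl (by omega))⟩)
    · by_cases hi2 : j + 1 + 2 = k
      · rw [if_pos hi2]
        exact .inl (.inr (.inl ⟨rfl, .inr (by omega)⟩))
      · rw [if_neg hi2]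
        by_cases hi1 : j + 1 + 1 = k
        · rw [if_pos hi1]
          exact .inl (.inl ⟨by omega, by omega, by omega, by omega, by omega,
            .inr (.inl (by omega))⟩)
        · rw [if_neg hi1]
          exact .inl (.inl ⟨by omega, by omega, by omega, by omega, by omega,
            .inr (.inr (.inl (by omega)))⟩)
    · rw [if_neg (by omega), if_neg (by omega)]
      exact .inl (.inl ⟨by omega, by omega, by omega, by omega, by omega,
        .inr (.inr (.inr (by omega)))⟩)
  · exact .inr (.inl ⟨by omega, by omega, by omega, by omega, by omega, .inl (by omega)⟩)

theorem isLabelEdge_of_adj {k : ℕ} (hk : 4 ≤ k) (hke : Even k)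
    {u v : (Fin k ⊕ Fin (k - 1)) ⊕ Fin 1}
    (h : (joinGraph (interlacedPathsGraph k) (SimpleGraph.pathGraph 1)).Adj u v) :
    IsLabelEdge k (interlacedLabel k u) (interlacedLabel k v) ∨
      IsLabelEdge k (interlacedLabel k v) (interlacedLabel k u) := by
  have htop : ∀ w : Fin k ⊕ Fin (k - 1), ∀ z : Fin 1,
      IsLabelEdge k (interlacedLabel k (.inl w)) (interlacedLabel k (.inr z)) := by
    intro w z
    refine .inr (.inr (.inr ⟨rfl, (interlacedLabel_bounds hk _).1, ?_⟩))
    refine (interlacedLabel_bounds hk _).2.lt_of_ne ?_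
    exact (interlacedLabel_injective k).ne (a₁ := Sum.inl w) (a₂ := Sum.inr z) (by simp)
  rcases u with u | u <;> rcases v with v | v
  · have h' : (interlacedPathsGraph k).Adj u v := by simpa [joinGraph] using h
    rcases ((SimpleGraph.fromRel_adj _ _ _).1 h').2 with h' | h'
    · exact isLabelEdge_of_interlacedRel hk hke h'
    · exact (isLabelEdge_of_interlacedRel hk hke h').symm
  · exact .inl (htop u v)
  · exact .inr (htop v u)
  · exact absurd (Subsingleton.elim u v) (fun h' => h.ne (by rw [h']))

theorem isClassC0_joinGraph_interlacedPathsGraph {k : ℕ} (hk : 4 ≤ k) (hke : Even k) :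
    IsClassC0 (joinGraph (interlacedPathsGraph k) (SimpleGraph.pathGraph 1)) := by
  have hinj := interlacedLabel_injective k
  have hb := interlacedLabel_bounds hk
  have hgen : ∀ u v w, u ≠ v → u ≠ w → v ≠ w →
      signedArea (labelPoint k (interlacedLabel k u)) (labelPoint k (interlacedLabel k v))
        (labelPoint k (interlacedLabel k w)) ≠ 0 := fun u v w huv huw hvw =>
    signedArea_labelPoint_ne_zero (hb u).1 (hb v).1 (hb w).1 (hb u).2 (hb v).2 (hb w).2
      (hinj.ne huv) (hinj.ne huw) (hinj.ne hvw)
  have hpos : Function.Injective fun v => labelPoint k (interlacedLabel k v) := by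
    intro u v huv
    by_contra hne
    -- Two coinciding points would span a triangle of area zero with any third vertex.
    obtain ⟨w, -, hw⟩ := Finset.exists_mem_notMem_of_card_lt_card
      (s := {u, v}) (t := Finset.univ) (Finset.card_le_two.trans_lt (by
        rw [Finset.card_univ, Fintype.card_sum, Fintype.card_sum, Fintype.card_fin,
          Fintype.card_fin]
        omega))
    rw [Finset.mem_insert, Finset.mem_singleton, not_or] at hw
    obtain ⟨hwu, hwv⟩ := hw
    refine hgen u v w hne (Ne.symm hwu) (Ne.symm hwv) ?_
    simp only at huv
    rw [huv, signedArea]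
    ring
  let D := straightLineDrawing (joinGraph (interlacedPathsGraph k) (SimpleGraph.pathGraph 1))
    (fun v => labelPoint k (interlacedLabel k v)) hpos hgen
  refine ⟨D, ?_⟩
  -- The absolute value rounded down to an even number groups `±s, ±(s + 1)` for even `s ≥ 2`. The
  -- top `k` is assigned to `0`, since its edge to the inner point crosses the chord from `-1` to
  -- `1`.
  let label : ℤ → ℤ := fun t => if t = k then 0 else 2 * (max t (-t) / 2)
  let E : ℤ → Sym2 ℤ := fun s => if s = 0 then s(0, (k : ℤ)) else s(-s, s + 1)
  let F : ℤ → Sym2 ℤ := fun s => if s = 0 then s(-1, 1) else s(-s - 1, s)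
  have hedge : ∀ e ∈ (joinGraph (interlacedPathsGraph k) (SimpleGraph.pathGraph 1)).edgeSet,
      ∃ u v, e = s(u, v) ∧ IsLabelEdge k (interlacedLabel k u) (interlacedLabel k v) := by
    intro e he
    induction e with | _ u v
    rcases isLabelEdge_of_adj hk hke he with h | h
    · exact ⟨u, v, rfl, h⟩
    · exact ⟨v, u, Sym2.eq_swap, h⟩
  have hpair : ∀ a b a' b' : ℤ, -k < a → b ≤ k → a' ≤ k → b' ≤ k → IsCrossingPair k a b a' b' →
      ∃ s, s(a, b) = E s ∧ s(a', b') = F s ∧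
        label a = s ∧ label b = s ∧ label a' = s ∧ label b' = s := by
    rintro a b a' b' ha hb ha' hb' (⟨s, h2, hs, rfl, rfl, rfl, rfl⟩ | ⟨rfl, rfl, rfl, rfl⟩)
    · rw [Nat.even_iff] at hke
      refine ⟨b', (if_neg (by omega)).symm, (if_neg (by omega)).symm, ?_, ?_, ?_, ?_⟩ <;>
        simp only [label] <;> rw [if_neg (by omega)] <;> omega
    · refine ⟨0, (if_pos rfl).symm, (if_pos rfl).symm, ?_, if_pos rfl, ?_, ?_⟩ <;>
        simp only [label] <;> rw [if_neg (by omega)] <;> norm_num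
  refine D.isC0Drawing_of_label (fun e f c c' => straightLineDrawing_crosses_unique)
    (fun v => label (interlacedLabel k v)) (Sym2.map.injective hinj) E F ?_
  intro e f c hc
  have hn : ∀ w, w ∈ e → w ∉ f := fun w hw => hc.notMem hw
  obtain ⟨u, v, rfl, huv⟩ := hedge e hc.1
  obtain ⟨u', v', rfl, huv'⟩ := hedge f hc.2.1
  simp only [Sym2.mem_iff, not_or] at hn
  have hnu := hn u (.inl rfl)
  have hnv := hn v (.inr rfl)
  simp only [Sym2.map_mk]
  rcases isCrossingPair_of_mem_segment (by exact_mod_cast hk) huv huv' (hinj.ne hnu.1)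
    (hinj.ne hnu.2) (hinj.ne hnv.1) (hinj.ne hnv.2) hc.2.2.2.1 hc.2.2.2.2.1 with h | h
  · obtain ⟨s, h1, h2, h3, h4, h5, h6⟩ := hpair _ _ _ _ (hb u).1 (hb v).2 (hb u').2 (hb v').2 h
    refine ⟨s, .inl ⟨h1, h2⟩, fun w hw => ?_⟩
    simp only [Sym2.mem_iff] at hw
    rcases hw with (rfl | rfl) | (rfl | rfl) <;> assumption
  · obtain ⟨s, h1, h2, h3, h4, h5, h6⟩ := hpair _ _ _ _ (hb u').1 (hb v').2 (hb u).2 (hb v).2 h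
    refine ⟨s, .inr ⟨h2, h1⟩, fun w hw => ?_⟩
    simp only [Sym2.mem_iff] at hw
    rcases hw with (rfl | rfl) | (rfl | rfl) <;> assumption

/-- The edges of the extremal graph, listed by the lengths of the six families. -/
def interlacedEdge {k : ℕ} (hk : 4 ≤ k) :
    Fin (k - 1) ⊕ Fin (k - 2) ⊕ Fin (k - 1) ⊕ Fin (k - 1) ⊕ Fin 1 ⊕ Fin (k / 2 - 1) →
      (Fin k ⊕ Fin (k - 1)) × (Fin k ⊕ Fin (k - 1))
  | .inl i => (.inl ⟨i, by omega⟩, .inl ⟨i + 1, by omega⟩)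
  | .inr (.inl i) => (.inr ⟨i, by omega⟩, .inr ⟨i + 1, by omega⟩)
  | .inr (.inr (.inl i)) => (.inl ⟨i, by omega⟩, .inr i)
  | .inr (.inr (.inr (.inl i))) => (.inl ⟨i + 1, by omega⟩, .inr i)
  | .inr (.inr (.inr (.inr (.inl _)))) => (.inl ⟨k - 3, by omega⟩, .inl ⟨k - 1, by omega⟩)
  | .inr (.inr (.inr (.inr (.inr i)))) => (.inl ⟨2 * i, by omega⟩, .inr ⟨2 * i + 1, by omega⟩)

theorem interlacedRel_interlacedEdge {k : ℕ} (hk : 4 ≤ k) (x) :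
    interlacedRel k (interlacedEdge hk x).1 (interlacedEdge hk x).2 := by
  rcases x with ⟨i, hi⟩ | ⟨i, hi⟩ | ⟨i, hi⟩ | ⟨i, hi⟩ | ⟨i, hi⟩ | ⟨i, hi⟩
  · exact .inl rfl
  · exact rfl
  · exact .inl rfl
  · exact .inr (.inl rfl)
  · exact .inr ⟨by dsimp only; omega, by dsimp only; omega⟩
  · exact .inr (.inr ⟨⟨i + 1, by dsimp only; omega⟩, by dsimp only; omega, rfl⟩)

/-- Ensures that listed pairs are not loops and that no edge is listed in both directions. -/
theorem interlacedRel_asymm {k : ℕ} {u v : Fin k ⊕ Fin (k - 1)} (h : interlacedRel k u v) :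
    ¬ interlacedRel k v u := by
  rcases u with i | i <;> rcases v with j | j <;> simp only [interlacedRel] at h ⊢ <;>
    first | exact id | omega

theorem interlacedEdge_injective {k : ℕ} (hk : 4 ≤ k) : Function.Injective (interlacedEdge hk) := by
  rintro (i | i | i | i | i | i) (j | j | j | j | j | j) h <;>
    simp only [interlacedEdge, Prod.mk.injEq, Sum.inl.injEq, Sum.inr.injEq,
      Fin.ext_iff, reduceCtorEq, and_false, false_and] at h ⊢ <;> omega

/-- The six families have `4k - 4 + (k/2 - 1)` members in total. The list need not be shown
exhaustive, because the general upper bound has the same value. -/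
theorem le_two_mul_ncard_edgeSet_interlacedPathsGraph {k : ℕ} (hk : 4 ≤ k) (hke : Even k) :
    9 * k ≤ 2 * (interlacedPathsGraph k).edgeSet.ncard + 10 := by
  have hmem : ∀ x, Sym2.mk (interlacedEdge hk x).1 (interlacedEdge hk x).2 ∈
      (interlacedPathsGraph k).edgeSet := by
    intro x
    have hx := interlacedRel_interlacedEdge hk x
    rw [SimpleGraph.mem_edgeSet, interlacedPathsGraph, SimpleGraph.fromRel_adj]
    refine ⟨fun h => ?_, .inl hx⟩
    rw [h] at hx
    exact interlacedRel_asymm hx hx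
  have hinj : Function.Injective fun x =>
      (⟨_, hmem x⟩ : (interlacedPathsGraph k).edgeSet) := by
    intro x y hxy
    rcases Sym2.eq_iff.1 (congrArg Subtype.val hxy) with ⟨h1, h2⟩ | ⟨h1, h2⟩
    · exact interlacedEdge_injective hk (Prod.ext h1 h2)
    · have hx := interlacedRel_interlacedEdge hk x
      rw [h1, h2] at hx
      exact (interlacedRel_asymm hx (interlacedRel_interlacedEdge hk y)).elim
  have := Nat.card_le_card_of_injective _ hinj
  rw [Nat.card_coe_set_eq] at this
  simp only [Nat.card_eq_fintype_card, Fintype.card_sum, Fintype.card_fin] at this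
  rw [Nat.even_iff] at hke
  omega

theorem mainTheorem8 :
    (∀ {V : Type*} [Finite V] (G : SimpleGraph V), 2 ≤ Nat.card V →
      IsClassC0 (joinGraph G (SimpleGraph.pathGraph 1)) →
        (G.edgeSet.ncard : ℝ) ≤ 2.25 * (Nat.card V : ℝ) - 2.75) ∧
    (∀ k : ℕ, Even k → 4 ≤ k →
      Nat.card (Fin k ⊕ Fin (k - 1)) = 2 * k - 1 ∧
      IsClassC0 (joinGraph (interlacedPathsGraph k) (SimpleGraph.pathGraph 1)) ∧
      ((interlacedPathsGraph k).edgeSet.ncard : ℝ) =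
        2.25 * (Nat.card (Fin k ⊕ Fin (k - 1)) : ℝ) - 2.75) := by
  refine ⟨fun {V} _ G hV hG => ?_, fun k hke hk => ?_⟩
  · have h : (4 * G.edgeSet.ncard + 11 : ℝ) ≤ 9 * Nat.card V := by
      exact_mod_cast hG.four_mul_ncard_edgeSet_add_le hV
    linarith
  · have hcard : Nat.card (Fin k ⊕ Fin (k - 1)) = 2 * k - 1 := by
      rw [Nat.card_eq_fintype_card, Fintype.card_sum, Fintype.card_fin, Fintype.card_fin]
      omega
    have hC0 := isClassC0_joinGraph_interlacedPathsGraph hk hke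
    have hle := hC0.four_mul_ncard_edgeSet_add_le (by omega)
    have hge := le_two_mul_ncard_edgeSet_interlacedPathsGraph hk hke
    have heq : 4 * (interlacedPathsGraph k).edgeSet.ncard + 11 =
        9 * Nat.card (Fin k ⊕ Fin (k - 1)) := by omega
    have heq' : (4 * (interlacedPathsGraph k).edgeSet.ncard + 11 : ℝ) =
        9 * Nat.card (Fin k ⊕ Fin (k - 1)) := by exact_mod_cast heq
    exact ⟨hcard, hC0, by linarith⟩
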